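/- **Theorem.** Let $\mathcal N_{A'\to B}$ be a quantum channel (a completely positive, trace-preserving linear map between the operators on finite-dimensional Hilbert spaces) and let $\alpha\in(1,2]$. Then $$C(\mathcal N)\;\le\; C^\dagger(\mathcal N)\;\le\;\widehat\Upsilon_\alpha(\mathcal N)\;\le\;\Upsilon_{\max}(\mathcal N)\;\le\;\min\{C_\beta(\mathcal N),\,C_\zeta(\mathcal N)\}.$$ The quantities are as follows; logarithms are in base two and the values lie in $[-\infty,\infty]$. *Capacities.* An unassisted classical code for $n$ uses of $\mathcal N$ with $m\ge1$ messages consists of states $\rho_1,\dots,\rho_m$ on $A'^n$ and a POVM $\Lambda_1,\dots,\Lambda_m$ on $B^n$; its rate is $\frac1n\log m$ and its success probability is $\frac1m\sum_k\operatorname{tr}[\Lambda_k\,\mathcal N^{\otimes n}(\rho_k)]$. A real number $r$ is an achievable rate if for every $\varepsilon\in(0,1)$ and all sufficiently large $n$ there is a code for $n$ uses with rate at least $r$ and success probability at least $1-\varepsilon$. It is a strong converse rate if for every $\varepsilon\in(0,1)$ and all sufficiently large $n$ there is no such code. The unassisted classical capacity $C(\mathcal N)$ is the supremum of the achievable rates,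 and the strong converse capacity $C^\dagger(\mathcal N)$ is the infimum of the strong converse rates. *Divergences.* For a state $\rho$ and a positive semidefinite $\sigma$ put $$\widehat D_\alpha(\rho\|\sigma)=\frac1{\alpha-1}\log\operatorname{tr}\Big[\sigma^{1/2}\big(\sigma^{-1/2}\rho\,\sigma^{-1/2}\big)^{\alpha}\sigma^{1/2}\Big]$$ (inverse on the support of $\sigma$) if $\operatorname{supp}\rho\subseteq\operatorname{supp}\sigma$, and $\widehat D_\alpha(\rho\|\sigma)=+\infty$ otherwise; put $D_{\max}(\rho\|\sigma)=\inf\{\log t\mid t>0,\ \rho\le t\sigma\}$ (with $\inf\emptyset=+\infty$). For $\mathbf D\in\{\widehat D_\alpha,D_{\max}\}$ and a completely positive map $\mathcal M_{A'\to B}$ put $$\mathbf D(\mathcal N\|\mathcal M)=\sup_{\rho_A}\mathbf D\big(\mathcal N_{A'\to B}(\phi_{AA'})\,\big\|\,\mathcal M_{A'\to B}(\phi_{AA'})\big),$$ where $\rho_A$ ranges over the states on a copy $A$ of $A'$ and $\phi_{AA'}$ is a purification of $\rho_A$. *Upsilon-informations.* Let $J_{\mathcal M}=(\mathrm{id}_A\otimes\mathcal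 M)\big(\sum_{i,j}|i\rangle\langle j|_A\otimes|i\rangle\langle j|_{A'}\big)$ be the Choi matrix of $\mathcal M$, let $\mathsf T_B$ be the partial transpose on $B$, and put $$\beta(J)=\min\big\{\operatorname{tr}S_B \,\big|\, R_{AB}\pm J^{\mathsf T_B}\ge0,\ \mathbb 1_A\otimes S_B\pm R_{AB}^{\mathsf T_B}\ge0\big\},$$ $$\mathcal V_\beta=\{\mathcal M_{A'\to B}\text{ completely positive}\mid\beta(J_{\mathcal M})\le1\}.$$ Then $\widehat\Upsilon_\alpha(\mathcal N)=\inf_{\mathcal M\in\mathcal V_\beta}\widehat D_\alpha(\mathcal N\|\mathcal M)$ and $\Upsilon_{\max}(\mathcal N)=\inf_{\mathcal M\in\mathcal V_\beta}D_{\max}(\mathcal N\|\mathcal M)$. Finally, $C_\beta(\mathcal N)=\log\beta(J_{\mathcal N})$ and $$C_\zeta(\mathcal N)=\log\min\big\{\operatorname{tr}S_B\,\big|\,J_{\mathcal N}\le K_{AB},\ \mathbb 1_A\otimes S_B\pm K_{AB}^{\mathsf T_B}\ge0\big\}.$$ -/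

import Mathlib

namespace QInfo

open Filter
open scoped Kronecker ComplexOrder

/-! A finite-dimensional quantum system with a fixed orthonormal basis is a finite index type `A`;
operators on it are `Matrix A A ℂ`. A bipartite system `AB` is indexed by `A × B`, and `n` copies
of `A` by `Fin n → A`. Logarithms are in base two. Quantities that may be infinite are
`EReal`-valued. -/

section States

variable {A R : Type*}

/-- Density operators. -/
def IsState [Fintype A] (ρ : Matrix A A ℂ) : Prop :=
  ρ.PosSemidef ∧ ρ.trace = 1

/-- The rank-one operator `|ψ⟩⟨ψ|`. -/
def ketbra (ψ : A → ℂ) : Matrix A A ℂ :=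
  Matrix.vecMulVec ψ (star ψ)

/-- `ψ`, a vector of the system `RA`, purifies `ρ`: tracing out `A` from `|ψ⟩⟨ψ|` leaves `ρ`. -/
def IsPurification [Fintype A] (ψ : R × A → ℂ) (ρ : Matrix R R ℂ) : Prop :=
  ∀ r r', ∑ a, ketbra ψ (r, a) (r', a) = ρ r r'

/-- The unnormalized maximally entangled vector `∑ i, |i⟩|i⟩`. -/
def maxEntangled (A : Type*) [DecidableEq A] : A × A → ℂ :=
  fun p => if p.1 = p.2 then 1 else 0

end States

section Channels

variable {A B : Type*}

/-- The action of `id_R ⊗ Φ` on operators of the system `RA`. -/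
def idTensor (R : Type*) (Φ : Matrix A A ℂ →ₗ[ℂ] Matrix B B ℂ)
    (X : Matrix (R × A) (R × A) ℂ) : Matrix (R × B) (R × B) ℂ :=
  Matrix.of fun p q => Φ (Matrix.of fun a a' => X (p.1, a) (q.1, a')) p.2 q.2

/-- Complete positivity: `id ⊗ Φ` preserves positivity for ancillas of every finite dimension. -/
def IsCP (Φ : Matrix A A ℂ →ₗ[ℂ] Matrix B B ℂ) : Prop :=
  ∀ (k : ℕ) (X : Matrix (Fin k × A) (Fin k × A) ℂ),
    X.PosSemidef → (idTensor (Fin k) Φ X).PosSemidef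

/-- Quantum channels: completely positive and trace preserving maps. -/
def IsChannel [Fintype A] [Fintype B] (N : Matrix A A ℂ →ₗ[ℂ] Matrix B B ℂ) : Prop :=
  IsCP N ∧ ∀ X, (N X).trace = X.trace

/-- The Choi matrix `(id ⊗ Φ)(|Φ⟩⟨Φ|)`, with `|Φ⟩ = ∑ i, |i⟩|i⟩`. -/
def choi [DecidableEq A] (Φ : Matrix A A ℂ →ₗ[ℂ] Matrix B B ℂ) : Matrix (A × B) (A × B) ℂ :=
  idTensor A Φ (ketbra (maxEntangled A))

/-- Transposition of the second tensor factor. -/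
def partialTranspose (X : Matrix (A × B) (A × B) ℂ) : Matrix (A × B) (A × B) ℂ :=
  Matrix.of fun p q => X (p.1, q.2) (q.1, p.2)

/-- The `n`-fold tensor power `N^{⊗ n}`: it sends the matrix unit `⊗ᵢ |aᵢ⟩⟨a'ᵢ|` to
`⊗ᵢ N(|aᵢ⟩⟨a'ᵢ|)`, extended linearly. -/
def tensorPow [Fintype A] [DecidableEq A] (N : Matrix A A ℂ →ₗ[ℂ] Matrix B B ℂ) (n : ℕ) :
    Matrix (Fin n → A) (Fin n → A) ℂ →ₗ[ℂ] Matrix (Fin n → B) (Fin n → B) ℂ where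
  toFun X := Matrix.of fun b b' =>
    ∑ a, ∑ a', X a a' * ∏ i, N (Matrix.single (a i) (a' i) 1) (b i) (b' i)
  map_add' X Y := by
    ext b b'
    simp [add_mul, Finset.sum_add_distrib]
  map_smul' c X := by
    ext b b'
    simp [mul_assoc, Finset.mul_sum]

end Channels

section Divergences

variable {A : Type*} [Fintype A] [DecidableEq A]

/-- The real power `X ^ s` of a positive semidefinite matrix, by functional calculus. Since
`(0 : ℝ) ^ s = 0` for `s ≠ 0`, a negative power is an inverse on the support of `X`. -/
noncomputable def psdPow (X : Matrix A A ℂ) (s : ℝ) : Matrix A A ℂ :=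
  cfc (fun x : ℝ => x ^ s) X

/-- `supp ρ ⊆ supp σ` for Hermitian operators; the support is the orthogonal complement of the
kernel. -/
def SuppLE (ρ σ : Matrix A A ℂ) : Prop :=
  ∀ v : A → ℂ, σ.mulVec v = 0 → ρ.mulVec v = 0

open Classical in
/-- The geometric Rényi divergence
`(α - 1)⁻¹ log₂ tr [σ^{1/2} (σ^{-1/2} ρ σ^{-1/2})^α σ^{1/2}]` if `supp ρ ⊆ supp σ`, and `+∞`
otherwise. -/
noncomputable def geometricRenyi (α : ℝ) (ρ σ : Matrix A A ℂ) : EReal :=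
  if SuppLE ρ σ then
    (((α - 1)⁻¹ * Real.logb 2
      (psdPow σ (1 / 2) * psdPow (psdPow σ (-(1 / 2)) * ρ * psdPow σ (-(1 / 2))) α
        * psdPow σ (1 / 2)).trace.re : ℝ) : EReal)
  else ⊤

/-- The max-relative entropy `inf {log₂ t | ρ ≤ t σ}` (`+∞` if there is no such `t`). -/
noncomputable def maxRelEntropy (ρ σ : Matrix A A ℂ) : EReal :=
  ⨅ (t : ℝ) (_ : 0 < t ∧ ((t : ℂ) • σ - ρ).PosSemidef), ((Real.logb 2 t : ℝ) : EReal)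

end Divergences

section ChannelDivergences

variable {A B : Type*} [Fintype A] [Fintype B] [DecidableEq A] [DecidableEq B]

/-- The channel divergence `sup_ρ D(N(φ) ‖ M(φ))`, where `φ` is a purification of the state `ρ` of
the reference system by a copy of the input system, on which the maps act. -/
noncomputable def channelDivergence
    (D : Matrix (A × B) (A × B) ℂ → Matrix (A × B) (A × B) ℂ → EReal)
    (N M : Matrix A A ℂ →ₗ[ℂ] Matrix B B ℂ) : EReal :=
  ⨆ (ρ : Matrix A A ℂ) (_ : IsState ρ) (ψ : A × A → ℂ) (_ : IsPurification ψ ρ),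
    D (idTensor A N (ketbra ψ)) (idTensor A M (ketbra ψ))

/-- The values `tr S` over the feasible points of the program that defines `β`. -/
def betaValues (J : Matrix (A × B) (A × B) ℂ) : Set ℝ :=
  {x | ∃ (R : Matrix (A × B) (A × B) ℂ) (S : Matrix B B ℂ),
    (R + partialTranspose J).PosSemidef ∧ (R - partialTranspose J).PosSemidef ∧
    ((1 : Matrix A A ℂ) ⊗ₖ S + partialTranspose R).PosSemidef ∧
    ((1 : Matrix A A ℂ) ⊗ₖ S - partialTranspose R).PosSemidef ∧
    x = S.trace.re}

/-- `β(J) = min {tr S | R ± J^{T_B} ≥ 0, 1 ⊗ S ± R^{T_B} ≥ 0}`. -/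
noncomputable def beta (J : Matrix (A × B) (A × B) ℂ) : ℝ :=
  sInf (betaValues J)

/-- The set `V_β` of completely positive maps `M` with `β(J_M) ≤ 1`. -/
def Vbeta (A B : Type*) [Fintype A] [Fintype B] [DecidableEq A] [DecidableEq B] :
    Set (Matrix A A ℂ →ₗ[ℂ] Matrix B B ℂ) :=
  {M | IsCP M ∧ beta (choi M) ≤ 1}

/-- The generalized Upsilon-information induced by `D`: the `D`-distance from `N` to `V_β`. -/
noncomputable def upsilon
    (D : Matrix (A × B) (A × B) ℂ → Matrix (A × B) (A × B) ℂ → EReal)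
    (N : Matrix A A ℂ →ₗ[ℂ] Matrix B B ℂ) : EReal :=
  ⨅ (M : Matrix A A ℂ →ₗ[ℂ] Matrix B B ℂ) (_ : M ∈ Vbeta A B), channelDivergence D N M

/-- The geometric Rényi Upsilon-information. -/
noncomputable def geometricUpsilon (α : ℝ) (N : Matrix A A ℂ →ₗ[ℂ] Matrix B B ℂ) : EReal :=
  upsilon (geometricRenyi α) N

/-- The max-Upsilon-information. -/
noncomputable def maxUpsilon (N : Matrix A A ℂ →ₗ[ℂ] Matrix B B ℂ) : EReal :=
  upsilon maxRelEntropy N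

/-- The bound `C_β(N) = log₂ β(J_N)`. -/
noncomputable def Cbeta (N : Matrix A A ℂ →ₗ[ℂ] Matrix B B ℂ) : ℝ :=
  Real.logb 2 (beta (choi N))

/-- The values `tr S` over the feasible points of the program that defines `C_ζ`. -/
def zetaValues (J : Matrix (A × B) (A × B) ℂ) : Set ℝ :=
  {x | ∃ (K : Matrix (A × B) (A × B) ℂ) (S : Matrix B B ℂ),
    (K - J).PosSemidef ∧
    ((1 : Matrix A A ℂ) ⊗ₖ S + partialTranspose K).PosSemidef ∧
    ((1 : Matrix A A ℂ) ⊗ₖ S - partialTranspose K).PosSemidef ∧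
    x = S.trace.re}

/-- The bound `C_ζ(N) = log₂ min {tr S | J_N ≤ K, 1 ⊗ S ± K^{T_B} ≥ 0}`. -/
noncomputable def Czeta (N : Matrix A A ℂ →ₗ[ℂ] Matrix B B ℂ) : ℝ :=
  Real.logb 2 (sInf (zetaValues (choi N)))

end ChannelDivergences

section Capacities

/-- An unassisted classical code for `n` uses of a channel from `A` to `B` with `m` messages: an
input state of `A^n` for every message, and a measurement of `B^n` with `m` outcomes. -/
structure ClassicalCode (A B : Type*) [Fintype A] [Fintype B] [DecidableEq B] (n m : ℕ) where
  enc : Fin m → Matrix (Fin n → A) (Fin n → A) ℂ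
  enc_isState : ∀ k, IsState (enc k)
  dec : Fin m → Matrix (Fin n → B) (Fin n → B) ℂ
  dec_posSemidef : ∀ k, (dec k).PosSemidef
  dec_sum : ∑ k, dec k = 1

variable {A B : Type*} [Fintype A] [Fintype B] [DecidableEq A] [DecidableEq B]

/-- The success probability of a code, averaged over uniformly distributed messages. -/
noncomputable def ClassicalCode.successProb {n m : ℕ} (c : ClassicalCode A B n m)
    (N : Matrix A A ℂ →ₗ[ℂ] Matrix B B ℂ) : ℝ :=
  (m : ℝ)⁻¹ * ∑ k, (c.dec k * tensorPow N n (c.enc k)).trace.re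

/-- There is a code for `n` uses of `N` with rate at least `r` and error at most `ε`. -/
def HasCode (N : Matrix A A ℂ →ₗ[ℂ] Matrix B B ℂ) (r : ℝ) (n : ℕ) (ε : ℝ) : Prop :=
  ∃ (m : ℕ) (c : ClassicalCode A B n m),
    0 < m ∧ r ≤ Real.logb 2 m / n ∧ 1 - ε ≤ c.successProb N

/-- `r` is achievable: at rate `r`, every positive error is eventually reached. -/
def IsAchievableRate (N : Matrix A A ℂ →ₗ[ℂ] Matrix B B ℂ) (r : ℝ) : Prop :=
  ∀ ε : ℝ, 0 < ε → ε < 1 → ∀ᶠ n : ℕ in atTop, HasCode N r n ε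

/-- `r` is a strong converse rate: the success probability of codes of rate at least `r` tends to
zero. -/
def IsStrongConverseRate (N : Matrix A A ℂ →ₗ[ℂ] Matrix B B ℂ) (r : ℝ) : Prop :=
  ∀ ε : ℝ, 0 < ε → ε < 1 → ∀ᶠ n : ℕ in atTop, ¬ HasCode N r n ε

/-- The unassisted classical capacity: the supremum of the achievable rates. -/
noncomputable def classicalCapacity (N : Matrix A A ℂ →ₗ[ℂ] Matrix B B ℂ) : EReal :=
  ⨆ (r : ℝ) (_ : IsAchievableRate N r), (r : EReal)

/-- The strong converse capacity: the infimum of the strong converse rates. -/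
noncomputable def strongConverseCapacity (N : Matrix A A ℂ →ₗ[ℂ] Matrix B B ℂ) : EReal :=
  ⨅ (r : ℝ) (_ : IsStrongConverseRate N r), (r : EReal)

end Capacities

end QInfo

/-! Everything rests on simultaneous diagonalisation by congruence. If `σ ≥ 0`, `ρ` is Hermitian and
`supp ρ ⊆ supp σ`, then `σ = L Lᴴ` and `ρ = L D Lᴴ` with `D` real diagonal and `L` left invertible
(`exists_congruence`). The operator inside the geometric Rényi divergence is then `G = L D^α Lᴴ`
(`psdPow_congruence`), so noncommuting operators are handled by scalar inequalities on the entries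
of `D`, and tensor powers only multiply these entries.

Strong converse: take `M ∈ V_β` and a real `d` with `D̂_α(N‖M) ≤ d < r`, and diagonalise the pair
`J_M`, `J_N`. The channel divergence bounds the partial trace: `tr_B G ≤ 2^((α-1)d) 1`. For a code
with `m` messages put `E = ∑ ρ_kᵀ ⊗ Λ_k`, so that `m` times the success probability is `tr[E
J_N^{⊗n}]`. Hölder's inequality on the diagonal entries gives `tr[E J_N^{⊗n}] ≤ tr[E
J_M^{⊗n}]^(1-1/α) · tr[E G^{⊗n}]^(1/α)`. The first trace is at most `x^n` for every feasible value
`x` of the program for `β`, because its two-sided constraints survive tensor powers; the second is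
at most `m 2^((α-1)dn)`. With `m ≥ 2^(rn)` the success probability is at most `(x
2^(d-r))^((1-1/α)n)`. Since `β(J_M) ≤ 1`, some `x < 2^(r-d)` is feasible, and the bound tends to
zero.

The remaining comparisons are shorter. If `ρ ≤ tσ` then `D ≤ t`, hence `D^α ≤ t^(α-1) D`, which
compares the two divergences. Rescaling `N` by `1/β(J_N)`, or taking the map with Choi matrix `K /
tr S`, gives a point of `V_β` that witnesses `C_β` or `C_ζ`. -/

namespace QInfo

open Filter Matrix
open scoped Kronecker ComplexOrder

set_option linter.unusedSectionVars false

/-! ### Functional calculus and simultaneous diagonalisation by congruence. -/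

section FunctionalCalculus

variable {A ι : Type*} [Fintype A] [DecidableEq A] [DecidableEq ι]

/-- A real diagonal matrix, with complex entries. -/
def rdiag (d : ι → ℝ) : Matrix ι ι ℂ := diagonal fun i => (d i : ℂ)

theorem rdiag_mul [Fintype ι] (d e : ι → ℝ) : rdiag d * rdiag e = rdiag fun i => d i * e i := by
  simp [rdiag]

theorem rdiag_conjTranspose (d : ι → ℝ) : (rdiag d)ᴴ = rdiag d := by
  simp only [rdiag, diagonal_conjTranspose]
  congr 1
  ext i
  simp

theorem rdiag_one : rdiag (fun _ : ι => (1 : ℝ)) = 1 := by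
  simp [rdiag]

variable [Fintype ι]

/-- One eigenbasis serves every `f`, so products of functions of `X` become products of diagonals.
-/
theorem exists_unitary_rdiag {X : Matrix A A ℂ} (hX : X.IsHermitian) :
    ∃ (U : Matrix A A ℂ) (e : A → ℝ), Uᴴ * U = 1 ∧ U * Uᴴ = 1 ∧ X = U * rdiag e * Uᴴ ∧
      (X.PosSemidef → ∀ i, 0 ≤ e i) ∧
      ∀ f : ℝ → ℝ, cfc f X = U * rdiag (fun i => f (e i)) * Uᴴ := by
  refine ⟨hX.eigenvectorUnitary, hX.eigenvalues, ?_, ?_, ?_, fun h => h.eigenvalues_nonneg,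
    fun f => ?_⟩
  · exact Unitary.coe_star_mul_self hX.eigenvectorUnitary
  · exact Unitary.coe_mul_star_self hX.eigenvectorUnitary
  · conv_lhs => rw [hX.spectral_theorem]
    rfl
  · rw [hX.cfc_eq]
    rfl

/-- Functional calculus for a matrix diagonalised by an isometry. -/
theorem cfc_isometry_conj {V : Matrix A ι ℂ} (hV : Vᴴ * V = 1) (D : ι → ℝ) {f : ℝ → ℝ}
    (hf : f 0 = 0) :
    cfc f (V * rdiag D * Vᴴ) = V * rdiag (fun i => f (D i)) * Vᴴ := by
  have hX : (V * rdiag D * Vᴴ).IsHermitian := by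
    simp [IsHermitian, conjTranspose_mul, rdiag_conjTranspose, Matrix.mul_assoc]
  obtain ⟨U, e, hU, hU', hUe, -, hcfc⟩ := exists_unitary_rdiag hX
  have h1 : rdiag e * (Uᴴ * V) = (Uᴴ * V) * rdiag D := by
    calc rdiag e * (Uᴴ * V) = Uᴴ * U * rdiag e * Uᴴ * V := by
          rw [hU]; simp [Matrix.mul_assoc]
      _ = Uᴴ * (U * rdiag e * Uᴴ) * V := by simp only [Matrix.mul_assoc]
      _ = Uᴴ * V * rdiag D * (Vᴴ * V) := by rw [← hUe]; simp only [Matrix.mul_assoc]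
      _ = _ := by rw [hV, Matrix.mul_one]
  -- By `h1`, a nonzero entry of `Uᴴ V` forces the two eigenvalues to agree, so the intertwining
  -- relation passes to `f`.
  have h2 : rdiag (fun i => f (e i)) * (Uᴴ * V) = (Uᴴ * V) * rdiag (fun i => f (D i)) := by
    ext i j
    have h := congrFun (congrFun h1 i) j
    simp only [rdiag, diagonal_mul, mul_diagonal] at h ⊢
    by_cases hz : (Uᴴ * V) i j = 0
    · simp [hz]
    · have : e i = D j := by
        rw [mul_comm] at h
        exact_mod_cast mul_left_cancel₀ hz h
      rw [this, mul_comm]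
  -- Off the range of `V` only the eigenvalue zero occurs; this is where `f 0 = 0` enters.
  have h3 : rdiag e * (Uᴴ * (1 - V * Vᴴ)) = 0 := by
    calc rdiag e * (Uᴴ * (1 - V * Vᴴ)) = Uᴴ * U * rdiag e * Uᴴ * (1 - V * Vᴴ) := by
          rw [hU]; simp [Matrix.mul_assoc]
      _ = Uᴴ * (U * rdiag e * Uᴴ) * (1 - V * Vᴴ) := by simp only [Matrix.mul_assoc]
      _ = Uᴴ * V * rdiag D * (Vᴴ - Vᴴ * V * Vᴴ) := by
          rw [← hUe]; simp only [Matrix.mul_assoc, Matrix.mul_sub, Matrix.mul_one]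
      _ = _ := by rw [hV, Matrix.one_mul, sub_self, Matrix.mul_zero]
  have h4 : rdiag (fun i => f (e i)) * (Uᴴ * (1 - V * Vᴴ)) = 0 := by
    ext i j
    have h := congrFun (congrFun h3 i) j
    simp only [rdiag, diagonal_mul, Matrix.zero_apply, mul_eq_zero] at h ⊢
    rcases h with h | h
    · left
      have : e i = 0 := by exact_mod_cast h
      simp [this, hf]
    · exact Or.inr h
  rw [hcfc]
  calc U * rdiag (fun i => f (e i)) * Uᴴ
      = U * (rdiag (fun i => f (e i)) * (Uᴴ * V)) * Vᴴ
        + U * (rdiag (fun i => f (e i)) * (Uᴴ * (1 - V * Vᴴ))) := by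
        simp only [Matrix.mul_assoc, Matrix.mul_sub, Matrix.mul_one]
        abel
    _ = (U * Uᴴ) * V * rdiag (fun i => f (D i)) * Vᴴ := by
        rw [h4, h2, Matrix.mul_zero, add_zero]
        simp only [Matrix.mul_assoc]
    _ = _ := by rw [hU', Matrix.one_mul]

/-- The geometric mean expression in a simultaneous diagonalisation by congruence. -/
theorem psdPow_congruence {α : ℝ} (hα : α ≠ 0) {L : Matrix A ι ℂ} {K : Matrix ι A ℂ}
    (hK : K * L = 1) (D : ι → ℝ) :
    psdPow (L * Lᴴ) (1 / 2) *
      psdPow (psdPow (L * Lᴴ) (-(1 / 2)) * (L * rdiag D * Lᴴ) * psdPow (L * Lᴴ) (-(1 / 2))) α *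
      psdPow (L * Lᴴ) (1 / 2) = L * rdiag (fun i => D i ^ α) * Lᴴ := by
  have hσ : (L * Lᴴ).PosSemidef := posSemidef_self_mul_conjTranspose L
  obtain ⟨U, e, hU, -, hUe, he, hcfc⟩ := exists_unitary_rdiag hσ.1
  have he := he hσ
  have hKL : Lᴴ * Kᴴ = 1 := by rw [← conjTranspose_mul, hK, conjTranspose_one]
  have hmul : ∀ d d' : A → ℝ, (U * rdiag d * Uᴴ) * (U * rdiag d' * Uᴴ)
      = U * rdiag (fun i => d i * d' i) * Uᴴ := fun d d' => by
    calc _ = U * rdiag d * (Uᴴ * U) * rdiag d' * Uᴴ := by simp only [Matrix.mul_assoc]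
      _ = _ := by rw [hU, Matrix.mul_one, Matrix.mul_assoc U, rdiag_mul]
  set Q := psdPow (L * Lᴴ) (1 / 2) with hQ
  set Qi := psdPow (L * Lᴴ) (-(1 / 2)) with hQi
  rw [psdPow, hcfc] at hQ hQi
  have herm : ∀ d : A → ℝ, (U * rdiag d * Uᴴ)ᴴ = U * rdiag d * Uᴴ := fun d => by
    simp [conjTranspose_mul, rdiag_conjTranspose, Matrix.mul_assoc]
  have hQh : Qᴴ = Q := by rw [hQ, herm]
  have hQih : Qiᴴ = Qi := by rw [hQi, herm]
  have e1 : Q * Qi * (L * Lᴴ) = L * Lᴴ := by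
    conv_lhs => rw [hQ, hQi, hUe]
    conv_rhs => rw [hUe]
    rw [hmul, hmul]
    congr 3
    ext i
    rcases (he i).eq_or_lt with h | h
    · simp [← h]
    · rw [← Real.rpow_add h]; simp
  have e2 : L * Lᴴ * (Qi * Qi) * (L * Lᴴ) = L * Lᴴ := by
    conv_lhs => rw [hQi, hUe]
    conv_rhs => rw [hUe]
    rw [hmul, hmul, hmul]
    congr 3
    ext i
    rcases (he i).eq_or_lt with h | h
    · simp [← h]
    · rw [← Real.rpow_add h]
      norm_num
      rw [Real.rpow_neg_one, mul_inv_cancel₀ h.ne', one_mul]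
  have hQQL : Q * (Qi * L) = L := by
    calc Q * (Qi * L) = Q * Qi * (L * Lᴴ) * Kᴴ := by
          simp only [Matrix.mul_assoc]; rw [hKL, Matrix.mul_one]
      _ = L * (Lᴴ * Kᴴ) := by rw [e1, Matrix.mul_assoc]
      _ = L := by rw [hKL, Matrix.mul_one]
  -- `σ^{-1/2} L` is an isometry, so `σ^{-1/2} ρ σ^{-1/2}` is already diagonalised by it with
  -- eigenvalues `D`, and its power can be read off.
  have hV : (Qi * L)ᴴ * (Qi * L) = 1 := by
    calc (Qi * L)ᴴ * (Qi * L) = (K * L) * Lᴴ * (Qi * Qi) * L * (Lᴴ * Kᴴ) := by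
          rw [hK, hKL, conjTranspose_mul, hQih]
          simp only [Matrix.mul_assoc, Matrix.one_mul, Matrix.mul_one]
      _ = K * (L * Lᴴ * (Qi * Qi) * (L * Lᴴ)) * Kᴴ := by simp only [Matrix.mul_assoc]
      _ = (K * L) * (Lᴴ * Kᴴ) := by rw [e2]; simp only [Matrix.mul_assoc]
      _ = 1 := by rw [hK, hKL, Matrix.mul_one]
  have hX : Qi * (L * rdiag D * Lᴴ) * Qi = (Qi * L) * rdiag D * (Qi * L)ᴴ := by
    rw [conjTranspose_mul, hQih]; simp only [Matrix.mul_assoc]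
  rw [hX, psdPow, cfc_isometry_conj (f := fun x => x ^ α) hV D (Real.zero_rpow hα)]
  calc _ = (Q * (Qi * L)) * rdiag (fun i => D i ^ α) * (Q * (Qi * L))ᴴ := by
        rw [conjTranspose_mul Q, hQh]; simp only [Matrix.mul_assoc]
    _ = _ := by rw [hQQL]

/-- Simultaneous diagonalisation by congruence. -/
theorem exists_congruence {ρ σ : Matrix A A ℂ} (hσ : σ.PosSemidef) (hρ : ρ.IsHermitian)
    (h : SuppLE ρ σ) :
    ∃ (s : Finset A) (L : Matrix A s ℂ) (K : Matrix s A ℂ) (D : s → ℝ),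
      K * L = 1 ∧ σ = L * Lᴴ ∧ ρ = L * rdiag D * Lᴴ := by
  obtain ⟨U, e, hU, hU', hUe, he, -⟩ := exists_unitary_rdiag hσ.1
  have he := he hσ
  -- Only the nonzero eigenvalues of `σ` are kept, so that `L` has a left inverse.
  let s : Finset A := Finset.univ.filter fun i => e i ≠ 0
  have hs : ∀ i : s, 0 < e i := fun i =>
    lt_of_le_of_ne (he i) (Ne.symm (Finset.mem_filter.1 i.2).2)
  obtain ⟨W, hWU⟩ : ∃ W : Matrix A s ℂ, ∀ a i, W a i = U a i := ⟨of fun a i => U a i, fun _ _ => rfl⟩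
  have hW : Wᴴ * W = 1 := by
    ext i j
    have := congrFun (congrFun hU i) j
    simp only [mul_apply, one_apply, conjTranspose_apply] at this ⊢
    simp only [hWU, this, Subtype.ext_iff]
  have hσW : σ = W * rdiag (fun i : s => e i) * Wᴴ := by
    rw [hUe]
    ext a b
    rw [mul_apply, mul_apply]
    simp only [rdiag, mul_diagonal, conjTranspose_apply, hWU]
    rw [Finset.sum_coe_sort s fun j => U a j * (e j : ℂ) * star (U b j)]
    refine (Finset.sum_subset (Finset.subset_univ s) fun j _ hj => ?_).symm
    have : e j = 0 := by simpa [s] using hj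
    simp [this]
  obtain ⟨L₀, hL₀⟩ : ∃ L₀, L₀ = W * rdiag fun i : s => Real.sqrt (e i) := ⟨_, rfl⟩
  obtain ⟨K₀, hK₀⟩ : ∃ K₀, K₀ = (rdiag fun i : s => (Real.sqrt (e i))⁻¹) * Wᴴ := ⟨_, rfl⟩
  have hσL : σ = L₀ * L₀ᴴ := by
    rw [hσW]
    calc _ = W * (rdiag (fun i : s => Real.sqrt (e i)) * rdiag fun i : s => Real.sqrt (e i)) * Wᴴ := by
          rw [rdiag_mul]; simp [Real.mul_self_sqrt (he _)]
      _ = _ := by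
          rw [hL₀, conjTranspose_mul, rdiag_conjTranspose]; simp only [Matrix.mul_assoc]
  have hKL : K₀ * L₀ = 1 := by
    calc K₀ * L₀ = (rdiag fun i : s => (Real.sqrt (e i))⁻¹) * (Wᴴ * W) *
          rdiag fun i : s => Real.sqrt (e i) := by simp only [hL₀, hK₀, Matrix.mul_assoc]
      _ = rdiag fun _ => 1 := by
          rw [hW, Matrix.mul_one, rdiag_mul]
          congr 1
          ext i
          exact inv_mul_cancel₀ (Real.sqrt_pos.2 (hs i)).ne'
      _ = 1 := rdiag_one
  have hP : L₀ * K₀ = W * Wᴴ := by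
    calc L₀ * K₀ = W * ((rdiag fun i : s => Real.sqrt (e i)) *
          rdiag fun i : s => (Real.sqrt (e i))⁻¹) * Wᴴ := by simp only [hL₀, hK₀, Matrix.mul_assoc]
      _ = W * rdiag (fun _ : s => (1 : ℝ)) * Wᴴ := by
          rw [rdiag_mul]
          congr 3
          ext i
          exact mul_inv_cancel₀ (Real.sqrt_pos.2 (hs i)).ne'
      _ = _ := by rw [rdiag_one, Matrix.mul_one]
  have hPh : (L₀ * K₀)ᴴ = L₀ * K₀ := by rw [hP, conjTranspose_mul, conjTranspose_conjTranspose]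
  have hσP : σ * (1 - L₀ * K₀) = 0 := by
    have : L₀ᴴ * (L₀ * K₀) = L₀ᴴ := by
      rw [← hPh, ← conjTranspose_mul, Matrix.mul_assoc, hKL, Matrix.mul_one]
    rw [hσL, Matrix.mul_sub, Matrix.mul_one, Matrix.mul_assoc, this, sub_self]
  -- `L₀ K₀` is the projection onto `supp σ`; the columns of its complement lie in `ker σ`, hence in
  -- `ker ρ`.
  have hρP : ρ * (1 - L₀ * K₀) = 0 := by
    ext i j
    have h1 := h ((1 - L₀ * K₀).col j) (by
      ext i; exact congrFun (congrFun hσP i) j)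
    exact congrFun h1 i
  have hρP' : ρ * (L₀ * K₀) = ρ := by
    rw [Matrix.mul_sub, Matrix.mul_one, sub_eq_zero] at hρP
    exact hρP.symm
  have hPρ : (L₀ * K₀) * ρ = ρ := by
    have := congrArg conjTranspose hρP'
    rwa [conjTranspose_mul, hPh, hρ.eq] at this
  have hWh : (K₀ * ρ * K₀ᴴ).IsHermitian := by
    simp [IsHermitian, conjTranspose_mul, hρ.eq, Matrix.mul_assoc]
  -- The unitary freedom in `σ = L₀ L₀ᴴ` is spent on diagonalising the compression of `ρ`.
  obtain ⟨V, D, hV, hV', hVD, -, -⟩ := exists_unitary_rdiag hWh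
  refine ⟨s, L₀ * V, Vᴴ * K₀, D, ?_, ?_, ?_⟩
  · calc _ = Vᴴ * (K₀ * L₀) * V := by simp only [Matrix.mul_assoc]
      _ = 1 := by rw [hKL, Matrix.mul_one, hV]
  · rw [hσL]
    calc _ = L₀ * (V * Vᴴ) * L₀ᴴ := by rw [hV', Matrix.mul_one]
      _ = _ := by rw [conjTranspose_mul L₀]; simp only [Matrix.mul_assoc]
  · calc ρ = (L₀ * K₀) * ρ * (L₀ * K₀)ᴴ := by rw [hPρ, hPh, hρP']
      _ = L₀ * (K₀ * ρ * K₀ᴴ) * L₀ᴴ := by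
          rw [conjTranspose_mul L₀]; simp only [Matrix.mul_assoc]
      _ = _ := by rw [hVD, conjTranspose_mul L₀]; simp only [Matrix.mul_assoc]

end FunctionalCalculus

/-! ### Kronecker powers and two-sided operator inequalities. -/

section TensorPower

variable {ι κ μ : Type*}

/-- The `n`-fold Kronecker power of a matrix. -/
def kronPow (X : Matrix ι κ ℂ) (n : ℕ) : Matrix (Fin n → ι) (Fin n → κ) ℂ :=
  of fun p q => ∏ i, X (p i) (q i)

theorem kronPow_mul [Fintype κ] [DecidableEq κ] (X : Matrix ι κ ℂ) (Y : Matrix κ μ ℂ) (n : ℕ) :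
    kronPow (X * Y) n = kronPow X n * kronPow Y n := by
  ext p q
  simp only [kronPow, of_apply, mul_apply, ← Finset.prod_mul_distrib]
  rw [Finset.prod_univ_sum, Fintype.piFinset_univ]

theorem kronPow_conjTranspose (X : Matrix ι κ ℂ) (n : ℕ) : kronPow Xᴴ n = (kronPow X n)ᴴ := by
  ext p q
  simp [kronPow]

theorem kronPow_rdiag [DecidableEq ι] (d : ι → ℝ) (n : ℕ) :
    kronPow (rdiag d) n = rdiag fun p : Fin n → ι => ∏ i, d (p i) := by
  ext p q
  simp only [kronPow, rdiag, of_apply, diagonal_apply]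
  split_ifs with h
  · subst h; simp
  · obtain ⟨i, hi⟩ := Function.ne_iff.1 h
    exact Finset.prod_eq_zero (Finset.mem_univ i) (if_neg hi)

theorem rdiag_posSemidef [Fintype ι] [DecidableEq ι] {d : ι → ℝ} (h : ∀ i, 0 ≤ d i) :
    (rdiag d).PosSemidef :=
  PosSemidef.diagonal fun i => by simpa using h i

theorem rdiag_add [DecidableEq ι] (d e : ι → ℝ) :
    rdiag d + rdiag e = rdiag fun i => d i + e i := by
  simp [rdiag]

theorem rdiag_sub [DecidableEq ι] (d e : ι → ℝ) :
    rdiag d - rdiag e = rdiag fun i => d i - e i := by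
  simp [rdiag]

theorem exists_conjTranspose_mul_self [Fintype ι] [DecidableEq ι] {X : Matrix ι ι ℂ}
    (hX : X.PosSemidef) : ∃ Y : Matrix ι ι ℂ, X = Yᴴ * Y := by
  obtain ⟨U, e, -, -, hUe, he, -⟩ := exists_unitary_rdiag hX.1
  refine ⟨rdiag (fun i => Real.sqrt (e i)) * Uᴴ, ?_⟩
  calc X = U * (rdiag (fun i => Real.sqrt (e i)) * rdiag fun i => Real.sqrt (e i)) * Uᴴ := by
        rw [rdiag_mul, hUe]; simp [Real.mul_self_sqrt (he hX _)]
    _ = _ := by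
        rw [conjTranspose_mul, rdiag_conjTranspose, conjTranspose_conjTranspose]
        simp only [Matrix.mul_assoc]

/-- The trace pairing of positive semidefinite matrices is nonnegative. -/
theorem trace_mul_re_nonneg [Fintype ι] [DecidableEq ι] {P Q : Matrix ι ι ℂ}
    (hP : P.PosSemidef) (hQ : Q.PosSemidef) : 0 ≤ (P * Q).trace.re := by
  obtain ⟨Y, rfl⟩ := exists_conjTranspose_mul_self hQ
  rw [← Matrix.mul_assoc, trace_mul_comm, ← Matrix.mul_assoc]
  exact (Complex.le_def.1 (hP.mul_mul_conjTranspose_same Y).trace_nonneg).1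

theorem trace_mul_re_mono [Fintype ι] [DecidableEq ι] {P Q Q' : Matrix ι ι ℂ}
    (hP : P.PosSemidef) (hQ : (Q' - Q).PosSemidef) : (P * Q).trace.re ≤ (P * Q').trace.re := by
  have := trace_mul_re_nonneg hP hQ
  rw [Matrix.mul_sub, trace_sub, Complex.sub_re] at this
  linarith

theorem posSemidef_of_add_sub [Fintype ι] {X Y : Matrix ι ι ℂ} (h₁ : (X + Y).PosSemidef)
    (h₂ : (X - Y).PosSemidef) : X.PosSemidef := by
  have h : X = (1 / 2 : ℝ) • ((X + Y) + (X - Y)) := by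
    ext i j
    simp
    ring
  rw [h]
  exact (h₁.add h₂).smul (by norm_num)

theorem isHermitian_of_add_sub {X Y : Matrix ι ι ℂ} (h₁ : (X + Y).PosSemidef)
    (h₂ : (X - Y).PosSemidef) : Y.IsHermitian := by
  have h : Y = (1 / 2 : ℝ) • ((X + Y) - (X - Y)) := by
    ext i j
    simp
    ring
  rw [h, IsHermitian, conjTranspose_smul, conjTranspose_sub, h₁.1.eq, h₂.1.eq]
  simp

/-- On `ker X` the quadratic form of `Y` has both signs, hence vanishes; a null vector of the form
of `X + Y ≥ 0` lies in its kernel. -/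
theorem suppLE_of_add_sub [Fintype ι] {X Y : Matrix ι ι ℂ} (h₁ : (X + Y).PosSemidef)
    (h₂ : (X - Y).PosSemidef) : SuppLE Y X := by
  intro v hv
  have e1 : star v ⬝ᵥ (X + Y) *ᵥ v = star v ⬝ᵥ Y *ᵥ v := by rw [add_mulVec, hv, zero_add]
  have e2 : star v ⬝ᵥ (X - Y) *ᵥ v = -(star v ⬝ᵥ Y *ᵥ v) := by
    rw [sub_mulVec, hv, zero_sub, dotProduct_neg]
  have n1 := h₁.dotProduct_mulVec_nonneg v
  have n2 := h₂.dotProduct_mulVec_nonneg v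
  rw [e1] at n1
  rw [e2] at n2
  have h0 : star v ⬝ᵥ (X + Y) *ᵥ v = 0 := by
    rw [e1]
    exact le_antisymm (neg_nonneg.1 n2) n1
  have := (h₁.dotProduct_mulVec_zero_iff v).1 h0
  rwa [add_mulVec, hv, zero_add] at this

/-- `-X ≤ Y ≤ X` implies `-X^{⊗n} ≤ Y^{⊗n} ≤ X^{⊗n}`. -/
theorem kronPow_add_sub_posSemidef [Fintype ι] [DecidableEq ι] {X Y : Matrix ι ι ℂ}
    (h₁ : (X + Y).PosSemidef) (h₂ : (X - Y).PosSemidef) (n : ℕ) :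
    (kronPow X n + kronPow Y n).PosSemidef ∧ (kronPow X n - kronPow Y n).PosSemidef := by
  obtain ⟨s, L, K, D, hK, hX, hY⟩ := exists_congruence (posSemidef_of_add_sub h₁ h₂)
    (isHermitian_of_add_sub h₁ h₂) (suppLE_of_add_sub h₁ h₂)
  have hK' : Lᴴ * Kᴴ = 1 := by rw [← conjTranspose_mul, hK, conjTranspose_one]
  have kX : K * X * Kᴴ = 1 := by
    rw [hX, ← Matrix.mul_assoc, hK, Matrix.one_mul, hK']
  have kY : K * Y * Kᴴ = rdiag D := by
    rw [hY, ← Matrix.mul_assoc, ← Matrix.mul_assoc, hK, Matrix.one_mul, Matrix.mul_assoc, hK',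
      Matrix.mul_one]
  -- Compressing `X ± Y` by `K` gives `1 ± D ≥ 0`. Products of numbers in `[-1, 1]` stay there,
  -- which is why the inequality has to be two-sided.
  have hD : ∀ i, |D i| ≤ 1 := fun i => by
    have a1 := (h₁.mul_mul_conjTranspose_same K).diag_nonneg (i := i)
    have a2 := (h₂.mul_mul_conjTranspose_same K).diag_nonneg (i := i)
    rw [Matrix.mul_add, Matrix.add_mul, kX, kY] at a1
    rw [Matrix.mul_sub, Matrix.sub_mul, kX, kY] at a2
    have a1 := (Complex.le_def.1 a1).1
    have a2 := (Complex.le_def.1 a2).1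
    simp [rdiag] at a1 a2
    exact abs_le.2 ⟨by linarith, a2⟩
  have hDn : ∀ p : Fin n → s, |∏ i, D (p i)| ≤ 1 := fun p => by
    rw [Finset.abs_prod]
    exact Finset.prod_le_one (fun _ _ => abs_nonneg _) fun _ _ => hD _
  have eX : kronPow X n = kronPow L n * rdiag (fun _ : Fin n → s => (1 : ℝ)) * (kronPow L n)ᴴ := by
    rw [hX, kronPow_mul, kronPow_conjTranspose, rdiag_one, Matrix.mul_one]
  have eY : kronPow Y n = kronPow L n * rdiag (fun p : Fin n → s => ∏ i, D (p i)) * (kronPow L n)ᴴ := by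
    rw [hY, kronPow_mul, kronPow_mul, kronPow_conjTranspose, kronPow_rdiag]
  have p1 := (rdiag_posSemidef (d := fun p : Fin n → s => 1 + ∏ i, D (p i)) fun p => by
    linarith [(abs_le.1 (hDn p)).1]).mul_mul_conjTranspose_same (kronPow L n)
  have p2 := (rdiag_posSemidef (d := fun p : Fin n → s => 1 - ∏ i, D (p i)) fun p => by
    linarith [(abs_le.1 (hDn p)).2]).mul_mul_conjTranspose_same (kronPow L n)
  rw [eX, eY, ← Matrix.add_mul, ← Matrix.mul_add, ← Matrix.sub_mul, ← Matrix.mul_sub, rdiag_add,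
    rdiag_sub]
  exact ⟨p1, p2⟩

theorem trace_kronPow [Fintype ι] [DecidableEq ι] (X : Matrix ι ι ℂ) (n : ℕ) :
    (kronPow X n).trace = X.trace ^ n := by
  simp only [trace, diag, kronPow, of_apply]
  exact (Fintype.sum_pow (fun i => X i i) n).symm

end TensorPower

/-! ### Pairing codes with Kronecker powers of Choi matrices. -/

section Pairing

variable {A B : Type*} [Fintype A] [Fintype B] {n : ℕ}

/-- The operator `ρᵀ ⊗ Λ`, as an operator on `n` copies of the system `AB`. -/
def prepMeas (ρ : Matrix (Fin n → A) (Fin n → A) ℂ) (Λ : Matrix (Fin n → B) (Fin n → B) ℂ) :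
    Matrix (Fin n → A × B) (Fin n → A × B) ℂ :=
  (ρᵀ ⊗ₖ Λ).submatrix (Equiv.arrowProdEquivProdArrow _ _ _) (Equiv.arrowProdEquivProdArrow _ _ _)

theorem prepMeas_posSemidef {ρ : Matrix (Fin n → A) (Fin n → A) ℂ}
    {Λ : Matrix (Fin n → B) (Fin n → B) ℂ} (hρ : ρ.PosSemidef) (hΛ : Λ.PosSemidef) :
    (prepMeas ρ Λ).PosSemidef :=
  (hρ.transpose.kronecker hΛ).submatrix _

theorem trace_prepMeas_mul_kronPow (ρ : Matrix (Fin n → A) (Fin n → A) ℂ)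
    (Λ : Matrix (Fin n → B) (Fin n → B) ℂ) (J : Matrix (A × B) (A × B) ℂ) :
    (prepMeas ρ Λ * kronPow J n).trace =
      ∑ b, ∑ b', Λ b b' * ∑ a, ∑ a', ρ a a' * ∏ i, J (a i, b' i) (a' i, b i) := by
  have key : ∀ f : (Fin n → A × B) → ℂ, ∑ p, f p = ∑ b : Fin n → B, ∑ a : Fin n → A,
      f fun i => (a i, b i) := fun f => by
    rw [← (Equiv.arrowProdEquivProdArrow (Fin n) (fun _ => A) (fun _ => B)).symm.sum_comp,
      Fintype.sum_prod_type_right]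
    rfl
  simp only [trace, diag, mul_apply, key]
  refine Finset.sum_congr rfl fun b _ => ?_
  rw [Finset.sum_comm]
  refine Finset.sum_congr rfl fun b' _ => ?_
  rw [Finset.sum_comm, Finset.mul_sum]
  refine Finset.sum_congr rfl fun a _ => ?_
  rw [Finset.mul_sum]
  refine Finset.sum_congr rfl fun a' _ => ?_
  simp only [prepMeas, submatrix_apply, kroneckerMap_apply, transpose_apply, kronPow, of_apply]
  rw [mul_comm (ρ _ _), mul_assoc]
  rfl

variable [DecidableEq A] [DecidableEq B]

/-- Partial transposition is self-adjoint for the trace pairing, and on a product operator it merely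
transposes the measurement factor, which preserves positivity. -/
theorem trace_prepMeas_partialTranspose (ρ : Matrix (Fin n → A) (Fin n → A) ℂ)
    (Λ : Matrix (Fin n → B) (Fin n → B) ℂ) (J : Matrix (A × B) (A × B) ℂ) :
    (prepMeas ρ Λ * kronPow (partialTranspose J) n).trace =
      (prepMeas ρ Λᵀ * kronPow J n).trace := by
  rw [trace_prepMeas_mul_kronPow, trace_prepMeas_mul_kronPow, Finset.sum_comm]
  rfl

theorem trace_prepMeas_one_kronecker (ρ : Matrix (Fin n → A) (Fin n → A) ℂ)
    (Λ : Matrix (Fin n → B) (Fin n → B) ℂ) (S : Matrix B B ℂ) :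
    (prepMeas ρ Λ * kronPow ((1 : Matrix A A ℂ) ⊗ₖ S) n).trace =
      ρ.trace * (Λ * kronPow S n).trace := by
  rw [trace_prepMeas_mul_kronPow, trace, trace]
  simp only [diag, mul_apply, Finset.mul_sum (s := Finset.univ (α := Fin n → B))]
  refine Finset.sum_congr rfl fun b _ => Finset.sum_congr rfl fun b' _ => ?_
  rw [mul_left_comm]
  congr 1
  rw [Finset.sum_mul]
  refine Finset.sum_congr rfl fun a _ => ?_
  rw [Finset.sum_eq_single a]
  · simp [kronPow]
  · intro a' _ h
    obtain ⟨i, hi⟩ := Function.ne_iff.1 h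
    rw [Finset.prod_eq_zero (Finset.mem_univ i), mul_zero]
    simp [Matrix.one_apply_ne hi.symm]
  · simp

/-- The partial trace over the second factor. -/
def traceRight (G : Matrix (A × B) (A × B) ℂ) : Matrix A A ℂ :=
  of fun a a' => ∑ b, G (a, b) (a', b)

theorem trace_prepMeas_one (ρ : Matrix (Fin n → A) (Fin n → A) ℂ)
    (G : Matrix (A × B) (A × B) ℂ) :
    (prepMeas ρ (1 : Matrix (Fin n → B) (Fin n → B) ℂ) * kronPow G n).trace =
      (ρᵀ * kronPow (traceRight G) n).trace := by
  rw [trace_prepMeas_mul_kronPow, trace]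
  simp only [diag, mul_apply, one_apply, ite_mul, one_mul, zero_mul, Finset.sum_ite_eq,
    Finset.mem_univ, if_true, transpose_apply]
  rw [Finset.sum_comm]
  conv_rhs => rw [Finset.sum_comm]
  refine Finset.sum_congr rfl fun a _ => ?_
  rw [Finset.sum_comm]
  refine Finset.sum_congr rfl fun a' _ => ?_
  rw [← Finset.mul_sum]
  simp only [kronPow, traceRight, of_apply]
  rw [Finset.prod_univ_sum, Fintype.piFinset_univ]

theorem choi_apply (Φ : Matrix A A ℂ →ₗ[ℂ] Matrix B B ℂ) (a a' : A) (b b' : B) :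
    choi Φ (a, b) (a', b') = Φ (Matrix.single a a' 1) b b' := by
  simp only [choi, idTensor, of_apply]
  refine congrArg (fun X => Φ X b b') (Matrix.ext fun x x' => ?_)
  simp only [ketbra, maxEntangled, vecMulVec_apply, Pi.star_apply, of_apply, single_apply]
  by_cases h : a = x <;> by_cases h' : a' = x' <;> simp [h, h']

/-- This turns success probabilities into linear functionals of `J_N^{⊗n}`. -/
theorem trace_mul_tensorPow (N : Matrix A A ℂ →ₗ[ℂ] Matrix B B ℂ)
    (ρ : Matrix (Fin n → A) (Fin n → A) ℂ) (Λ : Matrix (Fin n → B) (Fin n → B) ℂ) :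
    (Λ * tensorPow N n ρ).trace = (prepMeas ρ Λ * kronPow (choi N) n).trace := by
  rw [trace_prepMeas_mul_kronPow]
  simp only [trace, diag, mul_apply, choi_apply]
  rfl

end Pairing

/-! ### Choi matrices, complete positivity and purifications. -/

section Choi

variable {A B R : Type*} [Fintype A] [Fintype B] [DecidableEq A] [DecidableEq B]

/-- `T ⊗ 1`. -/
def ampl (B : Type*) [DecidableEq B] (T : Matrix R A ℂ) : Matrix (R × B) (A × B) ℂ :=
  T ⊗ₖ (1 : Matrix B B ℂ)

theorem map_apply_eq_sum_choi (Φ : Matrix A A ℂ →ₗ[ℂ] Matrix B B ℂ) (X : Matrix A A ℂ) (b b' : B) :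
    Φ X b b' = ∑ a, ∑ a', X a a' * choi Φ (a, b) (a', b') := by
  conv_lhs => rw [matrix_eq_sum_single X]
  simp only [map_sum, Matrix.sum_apply, choi_apply]
  refine Finset.sum_congr rfl fun a _ => Finset.sum_congr rfl fun a' _ => ?_
  have : Matrix.single a a' (X a a') = X a a' • Matrix.single a a' (1 : ℂ) := by
    simp [smul_single]
  rw [this, map_smul, Matrix.smul_apply, smul_eq_mul]

/-- A vector of `RA` is its coefficient matrix applied to one half of the maximally entangled
vector. Varying the input state thus amounts to a congruence of the Choi matrix. -/
theorem idTensor_ketbra (Φ : Matrix A A ℂ →ₗ[ℂ] Matrix B B ℂ) (ψ : R × A → ℂ) :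
    idTensor R Φ (ketbra ψ) =
      ampl B (of fun r a => ψ (r, a)) * choi Φ * (ampl B (of fun r a => ψ (r, a)))ᴴ := by
  ext ⟨r, b⟩ ⟨r', b'⟩
  simp only [idTensor, of_apply]
  rw [map_apply_eq_sum_choi, mul_apply, Fintype.sum_prod_type]
  simp only [mul_apply, Fintype.sum_prod_type, ampl, kroneckerMap_apply, conjTranspose_apply,
    of_apply, one_apply, ketbra, vecMulVec_apply, Pi.star_apply]
  rw [Finset.sum_comm]
  refine Finset.sum_congr rfl fun a' _ => ?_
  rw [Finset.sum_eq_single b' (by intro x _ hx; simp [hx.symm]) (by simp), Finset.sum_mul]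
  refine Finset.sum_congr rfl fun a _ => ?_
  rw [Finset.sum_eq_single b (by intro x _ hx; simp [hx.symm]) (by simp)]
  simp
  ring

theorem idTensor_ketbra_posSemidef [Fintype R] {Φ : Matrix A A ℂ →ₗ[ℂ] Matrix B B ℂ}
    (hΦ : (choi Φ).PosSemidef) (ψ : R × A → ℂ) : (idTensor R Φ (ketbra ψ)).PosSemidef := by
  rw [idTensor_ketbra]
  exact hΦ.mul_mul_conjTranspose_same _

theorem IsCP.choi_posSemidef {Φ : Matrix A A ℂ →ₗ[ℂ] Matrix B B ℂ} (hΦ : IsCP Φ) :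
    (choi Φ).PosSemidef := by
  let e := Fintype.equivFin A
  have h := (hΦ _ ((ketbra (maxEntangled A)).submatrix (Prod.map e.symm id) (Prod.map e.symm id))
    ((posSemidef_vecMulVec_self_star _).submatrix _)).submatrix
      (Prod.map e id : A × B → _)
  convert h using 1
  ext ⟨a, b⟩ ⟨a', b'⟩
  simp [choi, idTensor]

/-- A positive operator is a sum of rank-one terms, and each of these is sent to a congruence of the
Choi matrix. -/
theorem isCP_of_choi {Φ : Matrix A A ℂ →ₗ[ℂ] Matrix B B ℂ} (hΦ : (choi Φ).PosSemidef) :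
    IsCP Φ := by
  intro k X hX
  obtain ⟨Y, hY⟩ := exists_conjTranspose_mul_self hX
  have : idTensor (Fin k) Φ X = ∑ j, idTensor (Fin k) Φ (ketbra fun p => star (Y j p)) := by
    ext p q
    simp only [Matrix.sum_apply, idTensor, of_apply]
    rw [← Matrix.sum_apply, ← map_sum]
    refine congrArg (fun Z => Φ Z p.2 q.2) (Matrix.ext fun a a' => ?_)
    rw [hY]
    simp [mul_apply, Matrix.sum_apply, ketbra, vecMulVec_apply]
  rw [this]
  exact posSemidef_sum _ fun j _ => idTensor_ketbra_posSemidef hΦ _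

/-- The linear map with a given Choi matrix. -/
def ofChoi (K : Matrix (A × B) (A × B) ℂ) : Matrix A A ℂ →ₗ[ℂ] Matrix B B ℂ where
  toFun X := of fun b b' => ∑ a, ∑ a', X a a' * K (a, b) (a', b')
  map_add' X Y := by
    ext b b'
    simp [add_mul, Finset.sum_add_distrib]
  map_smul' c X := by
    ext b b'
    simp [mul_assoc, Finset.mul_sum]

theorem choi_ofChoi (K : Matrix (A × B) (A × B) ℂ) : choi (ofChoi K) = K := by
  ext ⟨a, b⟩ ⟨a', b'⟩
  rw [choi_apply]
  simp only [ofChoi, LinearMap.coe_mk, AddHom.coe_mk, of_apply]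
  rw [Finset.sum_eq_single a _ (by simp), Finset.sum_eq_single a' _ (by simp)]
  · simp
  · intro x _ hx
    simp [hx.symm]
  · intro x _ hx
    simp [hx.symm]

theorem choi_smul (c : ℂ) (Φ : Matrix A A ℂ →ₗ[ℂ] Matrix B B ℂ) : choi (c • Φ) = c • choi Φ := by
  ext ⟨a, b⟩ ⟨a', b'⟩
  simp [choi_apply]

theorem trace_choi (Φ : Matrix A A ℂ →ₗ[ℂ] Matrix B B ℂ) (hΦ : ∀ X, (Φ X).trace = X.trace) :
    (choi Φ).trace = Fintype.card A := by
  simp only [trace, diag, Fintype.sum_prod_type, choi_apply]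
  have : ∀ a, ∑ b, Φ (Matrix.single a a 1) b b = 1 := fun a => by
    have := hΦ (Matrix.single a a 1)
    rwa [trace_single_eq_same] at this
  simp [this]

theorem idTensor_smul_sub (Φ Ψ : Matrix A A ℂ →ₗ[ℂ] Matrix B B ℂ) (t : ℂ) (ψ : R × A → ℂ) :
    t • idTensor R Φ (ketbra ψ) - idTensor R Ψ (ketbra ψ) =
      ampl B (of fun r a => ψ (r, a)) * (t • choi Φ - choi Ψ) *
        (ampl B (of fun r a => ψ (r, a)))ᴴ := by
  rw [idTensor_ketbra, idTensor_ketbra]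
  simp [Matrix.mul_sub, Matrix.sub_mul]

theorem trace_idTensor_ketbra [Fintype R] {N : Matrix A A ℂ →ₗ[ℂ] Matrix B B ℂ}
    (hN : ∀ X, (N X).trace = X.trace) {ψ : R × A → ℂ} {ρ : Matrix R R ℂ}
    (h : IsPurification ψ ρ) : (idTensor R N (ketbra ψ)).trace = ρ.trace := by
  simp only [trace, diag, Fintype.sum_prod_type, idTensor, of_apply]
  refine Finset.sum_congr rfl fun r _ => ?_
  rw [← h r r]
  exact hN _

end Choi

/-! ### Comparison of the divergences. -/

section Comparison

variable {A B ι : Type*} [Fintype A] [DecidableEq A] [Fintype B] [DecidableEq B]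
  [Fintype ι] [DecidableEq ι]

/-- The weights do not depend on `d`, so traces against `L D Lᴴ`, `L Lᴴ` and `L D^α Lᴴ` are sums
with common weights. -/
theorem trace_mul_congruence (E : Matrix A A ℂ) (L : Matrix A ι ℂ) (d : ι → ℝ) :
    (E * (L * rdiag d * Lᴴ)).trace.re = ∑ i, ((Lᴴ * E * L) i i).re * d i := by
  have : (E * (L * rdiag d * Lᴴ)).trace = ((Lᴴ * E * L) * rdiag d).trace := by
    rw [← Matrix.mul_assoc, trace_mul_comm]
    simp only [Matrix.mul_assoc]
  rw [this]
  simp [trace, rdiag, mul_diagonal]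

theorem congruence_nonneg {ρ : Matrix A A ℂ} (hρ : ρ.PosSemidef) {L : Matrix A ι ℂ}
    {K : Matrix ι A ℂ} (hK : K * L = 1) {D : ι → ℝ} (h : ρ = L * rdiag D * Lᴴ) (i : ι) :
    0 ≤ D i := by
  have hK' : Lᴴ * Kᴴ = 1 := by rw [← conjTranspose_mul, hK, conjTranspose_one]
  have h1 := (hρ.mul_mul_conjTranspose_same K).diag_nonneg (i := i)
  have h2 : K * ρ * Kᴴ = rdiag D := by
    rw [h, ← Matrix.mul_assoc, ← Matrix.mul_assoc, hK, Matrix.one_mul, Matrix.mul_assoc, hK',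
      Matrix.mul_one]
  rw [h2] at h1
  simpa [rdiag] using h1

theorem suppLE_of_smul_sub {ρ σ : Matrix A A ℂ} (hρ : ρ.PosSemidef) {t : ℂ}
    (h : (t • σ - ρ).PosSemidef) : SuppLE ρ σ := by
  intro v hv
  have h1 := h.dotProduct_mulVec_nonneg v
  rw [sub_mulVec, smul_mulVec, hv, smul_zero, zero_sub, dotProduct_neg] at h1
  exact (hρ.dotProduct_mulVec_zero_iff v).1
    (le_antisymm (neg_nonneg.1 h1) (hρ.dotProduct_mulVec_nonneg v))

/-- The geometric Rényi divergence is at most the max-relative entropy. -/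
theorem geometricRenyi_le_maxRelEntropy {α : ℝ} (hα : 1 < α) {ρ σ : Matrix A A ℂ}
    (hρ : IsState ρ) (hσ : σ.PosSemidef) : geometricRenyi α ρ σ ≤ maxRelEntropy ρ σ := by
  refine le_iInf₂ fun t ⟨ht, htσ⟩ => ?_
  have hs : SuppLE ρ σ := suppLE_of_smul_sub hρ.1 htσ
  obtain ⟨s, L, K, D, hK, hL, hD⟩ := exists_congruence hσ hρ.1.1 hs
  have hD0 := congruence_nonneg hρ.1 hK hD
  have hDt : ∀ i, D i ≤ t := fun i => by
    have h : (t : ℂ) • σ - ρ = L * rdiag (fun i => t - D i) * Lᴴ := by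
      rw [← rdiag_sub, Matrix.mul_sub, Matrix.sub_mul, ← hD, hL]
      congr 1
      simp [rdiag, ← smul_one_eq_diagonal]
    have := congruence_nonneg htσ hK h i
    linarith
  rw [geometricRenyi, if_pos hs, EReal.coe_le_coe_iff]
  have hG : psdPow σ (1 / 2) *
      psdPow (psdPow σ (-(1 / 2)) * ρ * psdPow σ (-(1 / 2))) α * psdPow σ (1 / 2) =
      L * rdiag (fun i => D i ^ α) * Lᴴ := by
    rw [hL, hD]
    exact psdPow_congruence (by linarith) hK D
  rw [hG]
  have key : ∀ d : s → ℝ, (L * rdiag d * Lᴴ).trace.re = ∑ i, ((Lᴴ * L) i i).re * d i := fun d => by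
    have := trace_mul_congruence 1 L d
    rwa [Matrix.one_mul, Matrix.mul_one] at this
  have hw : ∀ i, 0 ≤ ((Lᴴ * L) i i).re := fun i =>
    (Complex.le_def.1 (posSemidef_conjTranspose_mul_self L).diag_nonneg).1
  have h1 : ∑ i, ((Lᴴ * L) i i).re * D i = 1 := by
    rw [← key, ← hD, hρ.2, Complex.one_re]
  -- Monotonicity of the logarithm needs a positive argument; the normalisation `h1` supplies a
  -- positive term.
  have hpos : 0 < ∑ i, ((Lᴴ * L) i i).re * D i ^ α := by
    obtain ⟨i, -, hi⟩ : ∃ i ∈ Finset.univ, 0 < ((Lᴴ * L) i i).re * D i := by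
      by_contra! hcon
      linarith [Finset.sum_nonpos hcon]
    refine Finset.sum_pos' (fun i _ => mul_nonneg (hw i) (Real.rpow_nonneg (hD0 i) _))
      ⟨i, Finset.mem_univ i, ?_⟩
    have hwi := (pos_and_pos_or_neg_and_neg_of_mul_pos hi).resolve_right
      fun h => absurd h.1 (hw i).not_gt
    exact mul_pos hwi.1 (Real.rpow_pos_of_pos hwi.2 _)
  have hle : ∑ i, ((Lᴴ * L) i i).re * D i ^ α ≤ t ^ (α - 1) := by
    calc _ ≤ ∑ i, t ^ (α - 1) * (((Lᴴ * L) i i).re * D i) := by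
          refine Finset.sum_le_sum fun i _ => ?_
          have : D i ^ α ≤ t ^ (α - 1) * D i := by
            rcases (hD0 i).eq_or_lt with h | h
            · rw [← h, Real.zero_rpow (by linarith), mul_zero]
            · have e : D i ^ α = D i ^ (α - 1) * D i := by
                rw [← Real.rpow_add_one h.ne', sub_add_cancel]
              rw [e]
              exact mul_le_mul_of_nonneg_right
                (Real.rpow_le_rpow (hD0 i) (hDt i) (by linarith)) (hD0 i)
          calc _ ≤ ((Lᴴ * L) i i).re * (t ^ (α - 1) * D i) :=
                mul_le_mul_of_nonneg_left this (hw i)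
            _ = _ := by ring
      _ = _ := by rw [← Finset.mul_sum, h1, mul_one]
  rw [key, inv_mul_le_iff₀ (by linarith), ← Real.logb_rpow_eq_mul_logb_of_pos ht]
  exact Real.logb_le_logb_of_le (by norm_num) hpos hle

theorem geometricUpsilon_le_maxUpsilon {α : ℝ} (hα : 1 < α)
    {N : Matrix A A ℂ →ₗ[ℂ] Matrix B B ℂ} (hN : IsChannel N) :
    geometricUpsilon α N ≤ maxUpsilon N := by
  refine iInf₂_mono fun M hM => ?_
  refine iSup₂_mono fun ρ hρ => iSup₂_mono fun ψ hψ => ?_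
  exact geometricRenyi_le_maxRelEntropy hα
    ⟨idTensor_ketbra_posSemidef hN.1.choi_posSemidef ψ, by
      rw [trace_idTensor_ketbra hN.2 hψ, hρ.2]⟩
    (idTensor_ketbra_posSemidef hM.1.choi_posSemidef ψ)

theorem maxRelEntropy_idTensor_le {N M : Matrix A A ℂ →ₗ[ℂ] Matrix B B ℂ} {t : ℝ} (ht : 0 < t)
    (h : ((t : ℂ) • choi M - choi N).PosSemidef) :
    channelDivergence maxRelEntropy N M ≤ (Real.logb 2 t : ℝ) := by
  refine iSup₂_le fun ρ _ => iSup₂_le fun ψ _ => iInf₂_le_of_le t ⟨ht, ?_⟩ le_rfl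
  rw [idTensor_smul_sub]
  exact h.mul_mul_conjTranspose_same _

/-! ### The programs for `β` and `C_ζ`, and the resulting bounds on the max-Upsilon-information. -/

theorem trace_partialTranspose (X : Matrix (A × B) (A × B) ℂ) :
    (partialTranspose X).trace = X.trace := rfl

theorem partialTranspose_smul (c : ℂ) (X : Matrix (A × B) (A × B) ℂ) :
    partialTranspose (c • X) = c • partialTranspose X := rfl

theorem partialTranspose_one_kronecker (S : Matrix B B ℂ) :
    partialTranspose ((1 : Matrix A A ℂ) ⊗ₖ S) = (1 : Matrix A A ℂ) ⊗ₖ Sᵀ := rfl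

theorem IsHermitian.partialTranspose {X : Matrix (A × B) (A × B) ℂ} (hX : X.IsHermitian) :
    (partialTranspose X).IsHermitian := by
  ext ⟨a, b⟩ ⟨a', b'⟩
  exact congrFun (congrFun hX (a, b')) (a', b)

theorem trace_re_nonneg {X : Matrix A A ℂ} (hX : X.PosSemidef) : 0 ≤ X.trace.re :=
  (Complex.le_def.1 hX.trace_nonneg).1

theorem exists_smul_one_add_sub_posSemidef {X : Matrix A A ℂ} (hX : X.IsHermitian) :
    ∃ c : ℝ, 0 ≤ c ∧ ((c : ℂ) • (1 : Matrix A A ℂ) + X).PosSemidef ∧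
      ((c : ℂ) • (1 : Matrix A A ℂ) - X).PosSemidef := by
  obtain ⟨U, e, -, hU, hUe, -, -⟩ := exists_unitary_rdiag hX
  have hc : ∀ i, |e i| ≤ ∑ j, |e j| := fun i =>
    Finset.single_le_sum (f := fun j => |e j|) (fun _ _ => abs_nonneg _) (Finset.mem_univ i)
  have h1 : ((∑ j, |e j| : ℝ) : ℂ) • (1 : Matrix A A ℂ) =
      U * rdiag (fun _ : A => ∑ j, |e j|) * Uᴴ := by
    rw [rdiag, ← smul_one_eq_diagonal, Matrix.mul_smul, Matrix.smul_mul, Matrix.mul_one, hU]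
  refine ⟨∑ j, |e j|, Finset.sum_nonneg fun _ _ => abs_nonneg _, ?_, ?_⟩
  · rw [h1, hUe, ← Matrix.add_mul, ← Matrix.mul_add, rdiag_add]
    exact (rdiag_posSemidef fun i => by linarith [neg_le_of_abs_le (hc i)]).mul_mul_conjTranspose_same U
  · rw [h1, hUe, ← Matrix.sub_mul, ← Matrix.mul_sub, rdiag_sub]
    exact (rdiag_posSemidef fun i => by linarith [le_of_abs_le (hc i)]).mul_mul_conjTranspose_same U

theorem betaValues_nonempty {J : Matrix (A × B) (A × B) ℂ} (hJ : J.IsHermitian) :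
    (betaValues J).Nonempty := by
  obtain ⟨c, hc, h1, h2⟩ := exists_smul_one_add_sub_posSemidef (IsHermitian.partialTranspose hJ)
  have e1 : (c : ℂ) • (1 : Matrix (A × B) (A × B) ℂ) =
      (1 : Matrix A A ℂ) ⊗ₖ ((c : ℂ) • (1 : Matrix B B ℂ)) := by
    rw [kronecker_smul, one_kronecker_one]
  refine ⟨_, (c : ℂ) • 1, (c : ℂ) • 1, h1, h2, ?_, ?_, rfl⟩
  · rw [e1, partialTranspose_one_kronecker, transpose_smul, transpose_one, ← e1]
    have : (0 : ℂ) ≤ c := by exact_mod_cast hc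
    exact (PosSemidef.one.smul this).add (PosSemidef.one.smul this)
  · rw [e1, partialTranspose_one_kronecker, transpose_smul, transpose_one, sub_self]
    exact PosSemidef.zero

/-- Taking traces in the constraints gives `tr J ≤ tr R ≤ |A| tr S`, as partial transposition
preserves the trace. -/
theorem trace_le_of_mem_betaValues {J : Matrix (A × B) (A × B) ℂ} {x : ℝ}
    (hx : x ∈ betaValues J) : J.trace.re ≤ Fintype.card A * x := by
  obtain ⟨R, S, -, h2, -, h4, rfl⟩ := hx
  have t2 := trace_re_nonneg h2
  have t4 := trace_re_nonneg h4
  rw [trace_sub, trace_partialTranspose, Complex.sub_re] at t2 t4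
  rw [trace_kronecker, trace_one] at t4
  simp at t4
  linarith

theorem trace_le_of_mem_zetaValues {J : Matrix (A × B) (A × B) ℂ} {x : ℝ}
    (hx : x ∈ zetaValues J) : J.trace.re ≤ Fintype.card A * x := by
  obtain ⟨K, S, h2, -, h4, rfl⟩ := hx
  have t2 := trace_re_nonneg h2
  have t4 := trace_re_nonneg h4
  rw [trace_sub, Complex.sub_re] at t2
  rw [trace_sub, trace_partialTranspose, Complex.sub_re, trace_kronecker, trace_one] at t4
  simp at t4
  linarith

theorem one_le_of_card_le [Nonempty A] {N : Matrix A A ℂ →ₗ[ℂ] Matrix B B ℂ} (hN : IsChannel N)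
    {x : ℝ} (h : (choi N).trace.re ≤ Fintype.card A * x) : 1 ≤ x := by
  rw [trace_choi N hN.2, Complex.natCast_re] at h
  have : (0 : ℝ) < Fintype.card A := by exact_mod_cast Fintype.card_pos
  nlinarith

theorem smul_mem_betaValues {J : Matrix (A × B) (A × B) ℂ} {x c : ℝ} (hc : 0 ≤ c)
    (hx : x ∈ betaValues J) : c * x ∈ betaValues ((c : ℂ) • J) := by
  obtain ⟨R, S, h1, h2, h3, h4, rfl⟩ := hx
  have hc' : (0 : ℂ) ≤ c := by exact_mod_cast hc
  refine ⟨(c : ℂ) • R, (c : ℂ) • S, ?_, ?_, ?_, ?_, ?_⟩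
  · rw [partialTranspose_smul, ← smul_add]; exact h1.smul hc'
  · rw [partialTranspose_smul, ← smul_sub]; exact h2.smul hc'
  · rw [partialTranspose_smul, kronecker_smul, ← smul_add]; exact h3.smul hc'
  · rw [partialTranspose_smul, kronecker_smul, ← smul_sub]; exact h4.smul hc'
  · simp

/-- Without a lower bound the real `sInf` would take its default value `0` and not be an infimum. -/
theorem betaValues_bddBelow [Nonempty A] (J : Matrix (A × B) (A × B) ℂ) :
    BddBelow (betaValues J) := by
  have : (0 : ℝ) < Fintype.card A := by exact_mod_cast Fintype.card_pos
  exact ⟨(Fintype.card A : ℝ)⁻¹ * J.trace.re, fun x hx =>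
    (inv_mul_le_iff₀ this).2 (trace_le_of_mem_betaValues hx)⟩

theorem beta_le_of_mem [Nonempty A] {J : Matrix (A × B) (A × B) ℂ} {x : ℝ}
    (hx : x ∈ betaValues J) : beta J ≤ x :=
  csInf_le (betaValues_bddBelow J) hx

theorem beta_smul_le [Nonempty A] {J : Matrix (A × B) (A × B) ℂ} (hJ : J.IsHermitian) {c : ℝ}
    (hc : 0 < c) : beta ((c : ℂ) • J) ≤ c * beta J := by
  rw [← inv_mul_le_iff₀ hc]
  refine le_csInf (betaValues_nonempty hJ) fun x hx => ?_
  rw [inv_mul_le_iff₀ hc]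
  exact beta_le_of_mem (smul_mem_betaValues hc.le hx)

theorem one_le_beta [Nonempty A] {N : Matrix A A ℂ →ₗ[ℂ] Matrix B B ℂ} (hN : IsChannel N) :
    1 ≤ beta (choi N) :=
  le_csInf (betaValues_nonempty hN.1.choi_posSemidef.1) fun _ hx =>
    one_le_of_card_le hN (trace_le_of_mem_betaValues hx)

theorem maxUpsilon_le_Cbeta [Nonempty A] {N : Matrix A A ℂ →ₗ[ℂ] Matrix B B ℂ}
    (hN : IsChannel N) : maxUpsilon N ≤ (Cbeta N : ℝ) := by
  have hβ := one_le_beta hN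
  have hJ := hN.1.choi_posSemidef
  set β := beta (choi N) with hβd
  have hβ0 : 0 < β := by linarith
  -- The witness is `N` rescaled to have `β ≤ 1`; it dominates `N` with the factor `t = β`.
  have hM : ((β⁻¹ : ℝ) : ℂ) • N ∈ Vbeta A B := by
    refine ⟨isCP_of_choi ?_, ?_⟩
    · rw [choi_smul]
      exact hJ.smul (by exact_mod_cast (inv_pos.2 hβ0).le)
    · rw [choi_smul]
      refine (beta_smul_le hJ.1 (inv_pos.2 hβ0)).trans ?_
      rw [← hβd, inv_mul_cancel₀ hβ0.ne']
  refine iInf₂_le_of_le _ hM (maxRelEntropy_idTensor_le hβ0 ?_)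
  rw [choi_smul, smul_smul, ← Complex.ofReal_mul, mul_inv_cancel₀ hβ0.ne', Complex.ofReal_one,
    one_smul, sub_self]
  exact PosSemidef.zero

theorem posSemidef_of_one_kronecker [Nonempty A] {S : Matrix B B ℂ}
    (h : ((1 : Matrix A A ℂ) ⊗ₖ S).PosSemidef) : S.PosSemidef := by
  convert h.submatrix (fun b : B => (Classical.arbitrary A, b)) using 1
  ext b b'
  simp

/-- The choice `R = 1 ⊗ S` works: its partial transpose is `1 ⊗ Sᵀ`, so `Sᵀ`, of the same trace,
meets the second pair of constraints. -/
theorem mem_betaValues_of_zeta [Nonempty A] {K : Matrix (A × B) (A × B) ℂ} {S : Matrix B B ℂ}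
    (h₁ : ((1 : Matrix A A ℂ) ⊗ₖ S + partialTranspose K).PosSemidef)
    (h₂ : ((1 : Matrix A A ℂ) ⊗ₖ S - partialTranspose K).PosSemidef) :
    S.trace.re ∈ betaValues K := by
  have h := posSemidef_of_add_sub h₁ h₂
  have hS := posSemidef_of_one_kronecker h
  refine ⟨(1 : Matrix A A ℂ) ⊗ₖ S, Sᵀ, h₁, h₂, ?_, ?_, by rw [trace_transpose]⟩
  · rw [partialTranspose_one_kronecker]
    have := PosSemidef.one (n := A) (R := ℂ) |>.kronecker hS.transpose
    exact this.add this
  · rw [partialTranspose_one_kronecker, sub_self]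
    exact PosSemidef.zero

theorem maxUpsilon_le_of_mem_zetaValues [Nonempty A] {N : Matrix A A ℂ →ₗ[ℂ] Matrix B B ℂ}
    (hN : IsChannel N) {x : ℝ} (hx : x ∈ zetaValues (choi N)) :
    maxUpsilon N ≤ (Real.logb 2 x : ℝ) := by
  have hx1 := one_le_of_card_le hN (trace_le_of_mem_zetaValues hx)
  have hx0 : 0 < x := by linarith
  obtain ⟨K, S, h1, h2, h3, rfl⟩ := hx
  set x := S.trace.re with hxd
  have hK : K.PosSemidef := by
    have := h1.add hN.1.choi_posSemidef
    rwa [sub_add_cancel] at this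
  -- The operator `K ≥ J_N ≥ 0` is itself a Choi matrix; divided by `x` it lies in `V_β` and still
  -- satisfies `J_N ≤ x J_M`.
  have hM : ofChoi (((x⁻¹ : ℝ) : ℂ) • K) ∈ Vbeta A B := by
    refine ⟨isCP_of_choi ?_, ?_⟩
    · rw [choi_ofChoi]
      exact hK.smul (by exact_mod_cast (inv_pos.2 hx0).le)
    · rw [choi_ofChoi]
      refine (beta_le_of_mem (smul_mem_betaValues (inv_pos.2 hx0).le
        (mem_betaValues_of_zeta h2 h3))).trans ?_
      rw [← hxd, inv_mul_cancel₀ hx0.ne']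
  refine iInf₂_le_of_le _ hM (maxRelEntropy_idTensor_le hx0 ?_)
  rw [choi_ofChoi, smul_smul, ← Complex.ofReal_mul, mul_inv_cancel₀ hx0.ne', Complex.ofReal_one,
    one_smul]
  exact h1

theorem zetaValues_nonempty {J : Matrix (A × B) (A × B) ℂ} (hJ : J.IsHermitian) :
    (zetaValues J).Nonempty := by
  obtain ⟨c, hc, h1, h2⟩ := exists_smul_one_add_sub_posSemidef hJ
  have e1 : (c : ℂ) • (1 : Matrix (A × B) (A × B) ℂ) =
      (1 : Matrix A A ℂ) ⊗ₖ ((c : ℂ) • (1 : Matrix B B ℂ)) := by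
    rw [kronecker_smul, one_kronecker_one]
  refine ⟨_, (c : ℂ) • 1, (c : ℂ) • 1, h2, ?_, ?_, rfl⟩
  · rw [e1, partialTranspose_one_kronecker, transpose_smul, transpose_one, ← e1]
    have : (0 : ℂ) ≤ c := by exact_mod_cast hc
    exact (PosSemidef.one.smul this).add (PosSemidef.one.smul this)
  · rw [e1, partialTranspose_one_kronecker, transpose_smul, transpose_one, sub_self]
    exact PosSemidef.zero

theorem maxUpsilon_le_Czeta [Nonempty A] {N : Matrix A A ℂ →ₗ[ℂ] Matrix B B ℂ}
    (hN : IsChannel N) : maxUpsilon N ≤ (Czeta N : ℝ) := by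
  have hne := zetaValues_nonempty hN.1.choi_posSemidef.1
  have hlb : ∀ x ∈ zetaValues (choi N), 1 ≤ x := fun x hx =>
    one_le_of_card_le hN (trace_le_of_mem_zetaValues hx)
  have hbdd : BddBelow (zetaValues (choi N)) := ⟨1, hlb⟩
  -- Attainment of the minimum is not needed: the bound holds at every feasible value and passes to
  -- the infimum by continuity of the logarithm.
  obtain ⟨u, -, hu, hmem⟩ := exists_seq_tendsto_sInf hne hbdd
  have h1 : (1 : ℝ) ≤ sInf (zetaValues (choi N)) := le_csInf hne hlb
  have hlim : Tendsto (fun n => ((Real.logb 2 (u n) : ℝ) : EReal)) atTop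
      (nhds ((Czeta N : ℝ) : EReal)) :=
    (continuous_coe_real_ereal.tendsto _).comp
      ((Real.continuousAt_logb (by linarith)).tendsto.comp hu)
  exact ge_of_tendsto' hlim fun n => maxUpsilon_le_of_mem_zetaValues hN (hmem n)

end Comparison

/-! ### The strong converse bound. -/

section Converse

variable {A B : Type*} [Fintype A] [DecidableEq A] [Fintype B] [DecidableEq B]

theorem trace_eq_re {X : Matrix B B ℂ} (hX : X.PosSemidef) : X.trace = (X.trace.re : ℂ) :=
  Complex.ext rfl (by simpa using (Complex.le_def.1 hX.trace_nonneg).2.symm)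

theorem ClassicalCode.dec_le_one {n m : ℕ} (c : ClassicalCode A B n m) (k : Fin m) :
    (1 - c.dec k).PosSemidef := by
  rw [← c.dec_sum, ← Finset.sum_erase_eq_sub (Finset.mem_univ k)]
  exact posSemidef_sum _ fun j _ => c.dec_posSemidef j

/-- The program for `β` bounds the total success weight of any code. -/
theorem ClassicalCode.sum_trace_le_pow [Nonempty A] {n m : ℕ} (c : ClassicalCode A B n m)
    (M : Matrix A A ℂ →ₗ[ℂ] Matrix B B ℂ) {x : ℝ} (hx : x ∈ betaValues (choi M)) :
    ∑ k, (c.dec k * tensorPow M n (c.enc k)).trace.re ≤ x ^ n := by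
  obtain ⟨R, S, h1, h2, h3, h4, rfl⟩ := hx
  have hS := posSemidef_of_one_kronecker (posSemidef_of_add_sub h3 h4)
  have hR := (kronPow_add_sub_posSemidef h1 h2 n).2
  have hS' := (kronPow_add_sub_posSemidef h3 h4 n).2
  have key : ∀ k, (c.dec k * tensorPow M n (c.enc k)).trace.re ≤
      (c.dec k * kronPow S n).trace.re := fun k => by
    have p1 := prepMeas_posSemidef (c.enc_isState k).1 (c.dec_posSemidef k).transpose
    have p2 := prepMeas_posSemidef (c.enc_isState k).1 (c.dec_posSemidef k)
    calc _ = (prepMeas (c.enc k) (c.dec k)ᵀ * kronPow (partialTranspose (choi M)) n).trace.re := by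
          rw [trace_mul_tensorPow, trace_prepMeas_partialTranspose, transpose_transpose]
      _ ≤ (prepMeas (c.enc k) (c.dec k)ᵀ * kronPow R n).trace.re := trace_mul_re_mono p1 hR
      _ = (prepMeas (c.enc k) (c.dec k) * kronPow (partialTranspose R) n).trace.re := by
          rw [trace_prepMeas_partialTranspose]
      _ ≤ _ := trace_mul_re_mono p2 hS'
      _ = _ := by rw [trace_prepMeas_one_kronecker, (c.enc_isState k).2, one_mul]
  calc _ ≤ ∑ k, (c.dec k * kronPow S n).trace.re := Finset.sum_le_sum fun k _ => key k
    _ = ((∑ k, c.dec k) * kronPow S n).trace.re := by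
        rw [Finset.sum_mul, trace_sum, Complex.re_sum]
    _ = _ := by
        rw [c.dec_sum, Matrix.one_mul, trace_kronPow, trace_eq_re hS, ← Complex.ofReal_pow,
          Complex.ofReal_re, Complex.ofReal_re]

theorem trace_ampl_congruence (T : Matrix A A ℂ) (G : Matrix (A × B) (A × B) ℂ) :
    (ampl B T * G * (ampl B T)ᴴ).trace = (Tᴴ * T * traceRight G).trace := by
  rw [trace_mul_comm, ← Matrix.mul_assoc]
  have : (ampl B T)ᴴ * ampl B T = (Tᴴ * T) ⊗ₖ (1 : Matrix B B ℂ) := by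
    rw [ampl, conjTranspose_kronecker, ← mul_kronecker_mul, conjTranspose_one, Matrix.one_mul]
  rw [this]
  simp only [trace, diag, mul_apply (M := _ ⊗ₖ _), Fintype.sum_prod_type, kroneckerMap_apply,
    one_apply, mul_ite, mul_one, mul_zero, ite_mul, zero_mul, Finset.sum_ite_eq, Finset.mem_univ,
    if_true]
  refine Finset.sum_congr rfl fun a _ => ?_
  rw [mul_apply, Finset.sum_comm]
  simp only [traceRight, of_apply, Finset.mul_sum]

theorem traceRight_posSemidef {G : Matrix (A × B) (A × B) ℂ} (hG : G.PosSemidef) :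
    (traceRight G).PosSemidef := by
  have : traceRight G = ∑ b, G.submatrix (fun a => (a, b)) fun a => (a, b) := by
    ext a a'
    simp [traceRight, Matrix.sum_apply]
  rw [this]
  exact posSemidef_sum _ fun b _ => hG.submatrix _

/-- An operator whose expectation in every faithful state is at most `c` is at most `c`. -/
theorem smul_one_sub_posSemidef {H : Matrix A A ℂ} (hH : H.IsHermitian) {c : ℝ}
    (h : ∀ T T' : Matrix A A ℂ, T' * T = 1 → T * T' = 1 → (T * Tᴴ).trace = 1 →
      (Tᴴ * T * H).trace.re ≤ c) : ((c : ℂ) • (1 : Matrix A A ℂ) - H).PosSemidef := by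
  have h1 : ∀ τ : Matrix A A ℂ, τ.PosDef → (τ * H).trace.re ≤ c * τ.trace.re := by
    intro τ hτ
    rcases isEmpty_or_nonempty A with hA | hA
    -- On the empty type there is no state to normalise, and both traces are zero.
    · simp [trace]
    obtain ⟨Y, rfl⟩ := exists_conjTranspose_mul_self hτ.posSemidef
    have hY : IsUnit Y := by
      have := (isUnit_iff_isUnit_det _).1 hτ.isUnit
      rw [det_mul] at this
      exact (isUnit_iff_isUnit_det _).2 (isUnit_of_mul_isUnit_right this)
    obtain ⟨Z, hZ1, hZ2⟩ := isUnit_iff_exists.1 hY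
    have ht : 0 < (Yᴴ * Y).trace.re := (Complex.lt_def.1 hτ.trace_pos).1
    set t := (Yᴴ * Y).trace.re with htd
    have htr : (Yᴴ * Y).trace = (t : ℂ) := trace_eq_re hτ.posSemidef
    obtain ⟨u, hu0, hu⟩ : ∃ u : ℝ, u ≠ 0 ∧ u * u = t⁻¹ :=
      ⟨Real.sqrt t⁻¹, (Real.sqrt_pos.2 (inv_pos.2 ht)).ne', Real.mul_self_sqrt (inv_pos.2 ht).le⟩
    have hu0' : (u : ℂ) ≠ 0 := by exact_mod_cast hu0
    have hu' : (u : ℂ) * u = (t⁻¹ : ℝ) := by exact_mod_cast hu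
    have e1 : ((u : ℂ) • Y)ᴴ = (u : ℂ) • Yᴴ := by simp [conjTranspose_smul]
    have := h ((u : ℂ) • Y) ((u : ℂ)⁻¹ • Z) 
      (by rw [smul_mul_smul_comm, hZ2, inv_mul_cancel₀ hu0', one_smul])
      (by rw [smul_mul_smul_comm, hZ1, mul_inv_cancel₀ hu0', one_smul]) (by
      rw [e1, smul_mul_smul_comm, trace_smul, trace_mul_comm, htr, hu', smul_eq_mul,
        ← Complex.ofReal_mul, inv_mul_cancel₀ ht.ne', Complex.ofReal_one])
    rw [e1, smul_mul_smul_comm, Matrix.smul_mul, trace_smul, hu', smul_eq_mul,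
      Complex.re_ofReal_mul, inv_mul_le_iff₀ ht] at this
    rwa [mul_comm c]
  refine .of_dotProduct_mulVec_nonneg ?_ fun v => ?_
  · simp [IsHermitian, hH.eq, conjTranspose_sub, conjTranspose_smul]
  have hherm : ((c : ℂ) • (1 : Matrix A A ℂ) - H).IsHermitian := by
    simp [IsHermitian, hH.eq, conjTranspose_sub, conjTranspose_smul]
  refine Complex.le_def.2 ⟨?_, (hherm.im_star_dotProduct_mulVec_self v).symm⟩
  have htr : ∀ X : Matrix A A ℂ, (vecMulVec v (star v) * X).trace = star v ⬝ᵥ X *ᵥ v := fun X => by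
    rw [trace_mul_comm, mul_vecMulVec, trace_vecMulVec, dotProduct_comm]
  -- The rank-one `vvᴴ` is perturbed to the positive definite `vvᴴ + ε 1`, to which `h1` applies;
  -- then `ε → 0`.
  have h2 : ∀ ε : ℝ, 0 < ε → (star v ⬝ᵥ H *ᵥ v).re + ε * H.trace.re ≤
      c * ((star v ⬝ᵥ v).re + ε * Fintype.card A) := fun ε hε => by
    have := h1 (vecMulVec v (star v) + (ε : ℂ) • 1)
      ((PosDef.one.smul (by exact_mod_cast hε : (0 : ℂ) < ε)).posSemidef_add
        (posSemidef_vecMulVec_self_star v))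
    rw [Matrix.add_mul, trace_add, htr, Matrix.smul_mul, Matrix.one_mul, trace_smul, trace_add,
      trace_smul, trace_one, trace_vecMulVec, dotProduct_comm v] at this
    simpa using this
  have h3 : (star v ⬝ᵥ H *ᵥ v).re ≤ c * (star v ⬝ᵥ v).re := by
    have l1 : Tendsto (fun ε : ℝ => (star v ⬝ᵥ H *ᵥ v).re + ε * H.trace.re)
        (nhdsWithin 0 (Set.Ioi 0)) (nhds ((star v ⬝ᵥ H *ᵥ v).re + 0 * H.trace.re)) :=
      (Continuous.tendsto (by fun_prop) 0).mono_left nhdsWithin_le_nhds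
    have l2 : Tendsto (fun ε : ℝ => c * ((star v ⬝ᵥ v).re + ε * Fintype.card A))
        (nhdsWithin 0 (Set.Ioi 0)) (nhds (c * ((star v ⬝ᵥ v).re + 0 * Fintype.card A))) :=
      (Continuous.tendsto (by fun_prop) 0).mono_left nhdsWithin_le_nhds
    have := le_of_tendsto_of_tendsto l1 l2 (eventually_mem_nhdsWithin.mono fun ε hε => h2 ε hε)
    simpa using this
  rw [sub_mulVec, dotProduct_sub, smul_mulVec, one_mulVec, dotProduct_smul, smul_eq_mul,
    Complex.sub_re, Complex.re_ofReal_mul, Complex.zero_re]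
  linarith

/-- A finite geometric Rényi channel divergence bounds the geometric mean of the Choi matrices. -/
theorem exists_congruence_of_channelDivergence_le [Nonempty A] {α d : ℝ} (hα : 1 < α)
    {N M : Matrix A A ℂ →ₗ[ℂ] Matrix B B ℂ} (hN : (choi N).PosSemidef) (hM : (choi M).PosSemidef)
    (h : channelDivergence (geometricRenyi α) N M ≤ (d : ℝ)) :
    ∃ (s : Finset (A × B)) (L : Matrix (A × B) s ℂ) (D : s → ℝ), (∀ i, 0 ≤ D i) ∧
      choi M = L * Lᴴ ∧ choi N = L * rdiag D * Lᴴ ∧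
      ((((2 : ℝ) ^ ((α - 1) * d) : ℝ) : ℂ) • (1 : Matrix A A ℂ) -
        traceRight (L * rdiag (fun i => D i ^ α) * Lᴴ)).PosSemidef := by
  have h' : ∀ T : Matrix A A ℂ, (T * Tᴴ).trace = 1 →
      geometricRenyi α (ampl B T * choi N * (ampl B T)ᴴ) (ampl B T * choi M * (ampl B T)ᴴ)
        ≤ (d : ℝ) := fun T hT => by
    have h1 := iSup₂_le_iff.1 (iSup₂_le_iff.1 h (T * Tᴴ) ⟨posSemidef_self_mul_conjTranspose T, hT⟩)
      (fun p => T p.1 p.2) (fun r r' => rfl)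
    rwa [idTensor_ketbra, idTensor_ketbra] at h1
  have hsupp : ∀ T : Matrix A A ℂ, (T * Tᴴ).trace = 1 →
      SuppLE (ampl B T * choi N * (ampl B T)ᴴ) (ampl B T * choi M * (ampl B T)ᴴ) := fun T hT => by
    by_contra hcon
    have h1 := h' T hT
    rw [geometricRenyi, if_neg hcon] at h1
    exact absurd h1 (by simp)
  have hampl : ∀ T T' : Matrix A A ℂ, T' * T = 1 → ampl B T' * ampl B T = 1 := fun T T' hT => by
    rw [ampl, ampl, ← mul_kronecker_mul, hT, Matrix.one_mul, one_kronecker_one]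
  -- The maximally mixed input makes the channel outputs scalar multiples of the Choi matrices.
  have hS : SuppLE (choi N) (choi M) := by
    have hc : (0 : ℝ) < Fintype.card A := by exact_mod_cast Fintype.card_pos
    obtain ⟨u, hu0, hu⟩ : ∃ u : ℝ, u ≠ 0 ∧ u * u = (Fintype.card A : ℝ)⁻¹ :=
      ⟨Real.sqrt (Fintype.card A : ℝ)⁻¹, (Real.sqrt_pos.2 (inv_pos.2 hc)).ne',
        Real.mul_self_sqrt (inv_pos.2 hc).le⟩
    have hu0' : (u : ℂ) ≠ 0 := by exact_mod_cast hu0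
    have hT := hsupp ((u : ℂ) • 1) (by
      have : (u : ℂ) * u = (Fintype.card A : ℂ)⁻¹ := by
        rw [← Complex.ofReal_mul, hu, Complex.ofReal_inv, Complex.ofReal_natCast]
      simp [conjTranspose_smul, smul_smul, this])
    have e : ampl B ((u : ℂ) • (1 : Matrix A A ℂ)) = (u : ℂ) • 1 := by
      rw [ampl, smul_kronecker, one_kronecker_one]
    intro v hv
    have h1 := hT v (by
      rw [e]
      simp [conjTranspose_smul, smul_mulVec, hv])
    rw [e] at h1
    simpa [conjTranspose_smul, smul_mulVec, hu0] using h1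
  obtain ⟨s, L, K, D, hK, hL, hD⟩ := exists_congruence hM hN.1 hS
  refine ⟨s, L, D, congruence_nonneg hN hK hD, hL, hD, ?_⟩
  have hG : (L * rdiag (fun i => D i ^ α) * Lᴴ).PosSemidef :=
    (rdiag_posSemidef fun i =>
      Real.rpow_nonneg (congruence_nonneg hN hK hD i) _).mul_mul_conjTranspose_same L
  refine smul_one_sub_posSemidef (traceRight_posSemidef hG).1 fun T T' hT hT' htr => ?_
  have h1 := h' T htr
  have eN : ampl B T * choi N * (ampl B T)ᴴ = (ampl B T * L) * rdiag D * (ampl B T * L)ᴴ := by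
    rw [hD, conjTranspose_mul]; simp only [Matrix.mul_assoc]
  have eM : ampl B T * choi M * (ampl B T)ᴴ = (ampl B T * L) * (ampl B T * L)ᴴ := by
    rw [hL, conjTranspose_mul]; simp only [Matrix.mul_assoc]
  -- Invertibility of `T` keeps the left inverse, so a single `D`, independent of the input, serves
  -- all faithful input states.
  have hKT : (K * ampl B T') * (ampl B T * L) = 1 := by
    calc _ = K * (ampl B T' * ampl B T) * L := by simp only [Matrix.mul_assoc]
      _ = 1 := by rw [hampl T T' hT, Matrix.mul_one, hK]
  rw [geometricRenyi, if_pos (hsupp T htr), eN, eM, psdPow_congruence (by linarith) hKT,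
    EReal.coe_le_coe_iff, inv_mul_le_iff₀ (by linarith)] at h1
  have eG : (ampl B T * L) * rdiag (fun i => D i ^ α) * (ampl B T * L)ᴴ =
      ampl B T * (L * rdiag (fun i => D i ^ α) * Lᴴ) * (ampl B T)ᴴ := by
    rw [conjTranspose_mul]; simp only [Matrix.mul_assoc]
  rw [eG, trace_ampl_congruence] at h1
  -- The logarithmic bound can be exponentiated only for a positive trace; otherwise the claim is
  -- trivial.
  rcases le_or_gt (Tᴴ * T * traceRight (L * rdiag (fun i => D i ^ α) * Lᴴ)).trace.re 0 with h0 | h0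
  · exact h0.trans (Real.rpow_nonneg (by norm_num) _)
  · exact (Real.logb_le_iff_le_rpow (by norm_num) h0).1 h1

theorem kronPow_posSemidef {ι : Type*} [Fintype ι] [DecidableEq ι] {X : Matrix ι ι ℂ}
    (hX : X.PosSemidef) (n : ℕ) : (kronPow X n).PosSemidef := by
  obtain ⟨Y, rfl⟩ := exists_conjTranspose_mul_self hX
  rw [kronPow_mul, kronPow_conjTranspose]
  exact posSemidef_conjTranspose_mul_self _

theorem kronPow_smul_one (c : ℝ) (n : ℕ) :
    kronPow ((c : ℂ) • (1 : Matrix A A ℂ)) n =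
      ((c ^ n : ℝ) : ℂ) • (1 : Matrix (Fin n → A) (Fin n → A) ℂ) := by
  have h1 : (c : ℂ) • (1 : Matrix A A ℂ) = rdiag fun _ => c := by
    rw [rdiag, smul_one_eq_diagonal]
  rw [h1, kronPow_rdiag, rdiag, smul_one_eq_diagonal]
  simp

theorem prepMeas_sub {n : ℕ} (ρ : Matrix (Fin n → A) (Fin n → A) ℂ)
    (Λ Λ' : Matrix (Fin n → B) (Fin n → B) ℂ) :
    prepMeas ρ (Λ - Λ') = prepMeas ρ Λ - prepMeas ρ Λ' := by
  ext p q
  simp [prepMeas, mul_sub]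

/-- Each `Λ_k ≤ 1` may be replaced by the identity, which leaves a pairing of `ρ_kᵀ` with `(tr_B
G)^{⊗n} ≤ c^n 1`. Every message contributes at most `c^n`, hence the factor `m`. -/
theorem ClassicalCode.sum_trace_kronPow_le {n m : ℕ} (C : ClassicalCode A B n m)
    {G : Matrix (A × B) (A × B) ℂ} (hG : G.PosSemidef) {c : ℝ} (hc : 0 ≤ c)
    (h : ((c : ℂ) • (1 : Matrix A A ℂ) - traceRight G).PosSemidef) :
    ∑ k, (prepMeas (C.enc k) (C.dec k) * kronPow G n).trace.re ≤ m * c ^ n := by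
  have hc' : (0 : ℂ) ≤ c := by exact_mod_cast hc
  have hH := (kronPow_add_sub_posSemidef
    ((PosSemidef.one.smul hc').add (traceRight_posSemidef hG)) h n).2
  have key : ∀ k, (prepMeas (C.enc k) (C.dec k) * kronPow G n).trace.re ≤ c ^ n := fun k => by
    have h1 := trace_mul_re_nonneg
      (prepMeas_posSemidef (C.enc_isState k).1 (C.dec_le_one k)) (kronPow_posSemidef hG n)
    rw [prepMeas_sub, Matrix.sub_mul, trace_sub, Complex.sub_re, sub_nonneg,
      trace_prepMeas_one] at h1
    refine h1.trans ((trace_mul_re_mono (C.enc_isState k).1.transpose hH).trans_eq ?_)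
    rw [kronPow_smul_one, Matrix.mul_smul, Matrix.mul_one, trace_smul, trace_transpose,
      (C.enc_isState k).2, smul_eq_mul, mul_one, Complex.ofReal_re]
  calc _ ≤ ∑ _k : Fin m, c ^ n := Finset.sum_le_sum fun k _ => key k
    _ = _ := by simp

/-- Hölder's inequality for the geometric mean. -/
theorem ClassicalCode.sum_trace_le_holder {n m : ℕ} (C : ClassicalCode A B n m) {ι : Type*}
    [Fintype ι] [DecidableEq ι] {α : ℝ} (hα : 1 ≤ α) {L : Matrix (A × B) ι ℂ} {D : ι → ℝ}
    (hD : ∀ i, 0 ≤ D i) :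
    ∑ k, (prepMeas (C.enc k) (C.dec k) * kronPow (L * rdiag D * Lᴴ) n).trace.re ≤
      (∑ k, (prepMeas (C.enc k) (C.dec k) * kronPow (L * Lᴴ) n).trace.re) ^ (1 - α⁻¹) *
      (∑ k, (prepMeas (C.enc k) (C.dec k) *
        kronPow (L * rdiag (fun i => D i ^ α) * Lᴴ) n).trace.re) ^ α⁻¹ := by
  set E := ∑ k, prepMeas (C.enc k) (C.dec k) with hE
  have hEp : E.PosSemidef := posSemidef_sum _ fun k _ =>
    prepMeas_posSemidef (C.enc_isState k).1 (C.dec_posSemidef k)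
  have hsum : ∀ X, ∑ k, (prepMeas (C.enc k) (C.dec k) * X).trace.re = (E * X).trace.re := fun X => by
    rw [hE, Finset.sum_mul, trace_sum, Complex.re_sum]
  have hw : ∀ d : ι → ℝ, (E * kronPow (L * rdiag d * Lᴴ) n).trace.re =
      ∑ p, (((kronPow L n)ᴴ * E * kronPow L n) p p).re * ∏ i, d (p i) := fun d => by
    rw [kronPow_mul, kronPow_mul, kronPow_rdiag, kronPow_conjTranspose, trace_mul_congruence]
  have hw1 := hw fun _ => 1
  simp only [rdiag_one, Matrix.mul_one, Finset.prod_const_one, mul_one] at hw1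
  rw [hsum, hsum, hsum, hw, hw, hw1]
  have := Real.inner_le_weight_mul_Lp_of_nonneg Finset.univ hα
    (fun p => (((kronPow L n)ᴴ * E * kronPow L n) p p).re) (fun p => ∏ i, D (p i))
    (fun p => (Complex.le_def.1 (hEp.conjTranspose_mul_mul_same (kronPow L n)).diag_nonneg).1)
    (fun p => Finset.prod_nonneg fun i _ => hD _)
  refine this.trans_eq ?_
  congr 2
  refine Finset.sum_congr rfl fun p _ => ?_
  rw [Real.finsetProd_rpow _ _ fun i _ => hD _]

theorem isStrongConverseRate_of_channelDivergence_lt [Nonempty A] {α r : ℝ} (hα : 1 < α)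
    {N M : Matrix A A ℂ →ₗ[ℂ] Matrix B B ℂ} (hN : IsCP N) (hM : M ∈ Vbeta A B)
    (h : channelDivergence (geometricRenyi α) N M < (r : ℝ)) : IsStrongConverseRate N r := by
  obtain ⟨d, hd, hdr⟩ := EReal.lt_iff_exists_real_btwn.1 h
  have hdr : d < r := EReal.coe_lt_coe_iff.1 hdr
  obtain ⟨s, L, D, hD, hL, hLD, hG⟩ := exists_congruence_of_channelDivergence_le hα
    hN.choi_posSemidef hM.1.choi_posSemidef hd.le
  have h2 : (0 : ℝ) < 2 := by norm_num
  -- The gap `d < r` leaves room for a feasible value slightly above the infimum.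
  obtain ⟨x, hx, hxlt⟩ : ∃ x ∈ betaValues (choi M), x < (2 : ℝ) ^ (r - d) :=
    exists_lt_of_csInf_lt (betaValues_nonempty hM.1.choi_posSemidef.1)
      (lt_of_le_of_lt hM.2 (Real.one_lt_rpow (by norm_num) (by linarith)))
  have hx0 : 0 ≤ x := by
    have h1 := trace_le_of_mem_betaValues hx
    have h3 := trace_re_nonneg hM.1.choi_posSemidef
    have : (0 : ℝ) < Fintype.card A := by exact_mod_cast Fintype.card_pos
    exact nonneg_of_mul_nonneg_right (h3.trans h1) this
  have hα0 : 0 < α := by linarith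
  have hy : 0 < 1 - α⁻¹ := by
    have := inv_lt_one_of_one_lt₀ hα
    linarith
  set y := 1 - α⁻¹ with hyd
  set q := (x * 2 ^ (d - r)) ^ y with hq
  have hxq : x * (2 : ℝ) ^ (d - r) < 1 := by
    have := mul_lt_mul_of_pos_right hxlt (Real.rpow_pos_of_pos h2 (d - r))
    rwa [← Real.rpow_add h2, sub_add_sub_cancel, sub_self, Real.rpow_zero] at this
  have hb0 : 0 ≤ x * (2 : ℝ) ^ (d - r) := mul_nonneg hx0 (Real.rpow_nonneg h2.le _)
  have hq1 : q < 1 := Real.rpow_lt_one hb0 hxq hy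
  have hq0 : 0 ≤ q := Real.rpow_nonneg hb0 _
  intro ε hε hε1
  have hev : ∀ᶠ n : ℕ in atTop, q ^ n < 1 - ε :=
    (tendsto_pow_atTop_nhds_zero_of_lt_one hq0 hq1).eventually_lt_const (by linarith)
  filter_upwards [hev, eventually_gt_atTop 0] with n hn hn0
  rintro ⟨m, C, hm, hrm, hsucc⟩
  have hm0 : (0 : ℝ) < m := by exact_mod_cast hm
  have hn0' : (0 : ℝ) < n := by exact_mod_cast hn0
  set c : ℝ := 2 ^ ((α - 1) * d) with hc
  have hc0 : 0 < c := Real.rpow_pos_of_pos h2 _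
  have hGp : (L * rdiag (fun i => D i ^ α) * Lᴴ).PosSemidef :=
    (rdiag_posSemidef fun i => Real.rpow_nonneg (hD i) _).mul_mul_conjTranspose_same L
  have b1 := C.sum_trace_kronPow_le hGp hc0.le hG
  have b2 := C.sum_trace_le_pow M hx
  have b3 := C.sum_trace_le_holder hα.le (L := L) hD
  simp only [trace_mul_tensorPow, hL] at b2
  rw [← hLD] at b3
  simp only [ClassicalCode.successProb, trace_mul_tensorPow] at hsucc
  have nonneg : ∀ X : Matrix (A × B) (A × B) ℂ, X.PosSemidef →
      0 ≤ ∑ k, (prepMeas (C.enc k) (C.dec k) * kronPow X n).trace.re := fun X hX =>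
    Finset.sum_nonneg fun k _ => trace_mul_re_nonneg
      (prepMeas_posSemidef (C.enc_isState k).1 (C.dec_posSemidef k)) (kronPow_posSemidef hX n)
  have b4 : ∑ k, (prepMeas (C.enc k) (C.dec k) * kronPow (choi N) n).trace.re ≤
      (x ^ n) ^ y * (m * c ^ n) ^ α⁻¹ :=
    b3.trans (mul_le_mul
      (Real.rpow_le_rpow (nonneg _ (posSemidef_self_mul_conjTranspose L)) b2 hy.le)
      (Real.rpow_le_rpow (nonneg _ hGp) b1 (inv_pos.2 hα0).le)
      (Real.rpow_nonneg (nonneg _ hGp) _) (Real.rpow_nonneg (pow_nonneg hx0 _) _))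
  have hmr : (2 : ℝ) ^ (r * n) ≤ m := by
    rw [le_div_iff₀ hn0'] at hrm
    exact (Real.le_logb_iff_rpow_le (by norm_num) hm0).1 hrm
  -- Here `(α - 1)/α = 1 - 1/α = y`, so all exponents combine into a `y`-th power.
  have e1 : (c ^ n) ^ α⁻¹ = ((2 : ℝ) ^ (d * n)) ^ y := by
    rw [hc, ← Real.rpow_natCast, ← Real.rpow_mul h2.le, ← Real.rpow_mul h2.le,
      ← Real.rpow_mul h2.le, hyd]
    congr 1
    field_simp
  have e2 : (m : ℝ) ^ α⁻¹ = m * ((m : ℝ) ^ y)⁻¹ := by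
    rw [← Real.rpow_neg hm0.le, ← Real.rpow_one_add' hm0.le (by rw [hyd]; simp [hα0.ne']), hyd]
    congr 1
    ring
  have e3 : (x ^ n) ^ y * (2 ^ (d * n)) ^ y = q ^ n * (2 ^ (r * n)) ^ y := by
    rw [hq, ← Real.rpow_natCast (_ ^ y), ← Real.rpow_mul hb0, mul_comm y, Real.rpow_mul hb0,
      Real.rpow_natCast, ← Real.mul_rpow (by positivity) (by positivity),
      ← Real.mul_rpow (by positivity) (by positivity), mul_pow, ← Real.rpow_natCast (2 ^ (d - r)),
      ← Real.rpow_mul h2.le, mul_assoc, ← Real.rpow_add h2]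
    congr 3
    ring
  have b5 : (m : ℝ)⁻¹ * ∑ k, (prepMeas (C.enc k) (C.dec k) * kronPow (choi N) n).trace.re ≤ q ^ n := by
    rw [inv_mul_le_iff₀ hm0]
    refine b4.trans ?_
    rw [Real.mul_rpow hm0.le (by positivity), e1, e2]
    have hmy : 0 < (m : ℝ) ^ y := Real.rpow_pos_of_pos hm0 _
    calc _ = m * ((x ^ n) ^ y * (2 ^ (d * n)) ^ y) * ((m : ℝ) ^ y)⁻¹ := by ring
      _ = m * q ^ n * ((2 ^ (r * n)) ^ y * ((m : ℝ) ^ y)⁻¹) := by rw [e3]; ring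
      _ ≤ m * q ^ n * 1 := by
          refine mul_le_mul_of_nonneg_left ?_ (by positivity)
          rw [mul_inv_le_iff₀ hmy, one_mul]
          exact Real.rpow_le_rpow (by positivity) hmr hy.le
      _ = _ := mul_one _
  linarith

theorem strongConverseCapacity_le_geometricUpsilon [Nonempty A] {α : ℝ} (hα : 1 < α)
    {N : Matrix A A ℂ →ₗ[ℂ] Matrix B B ℂ} (hN : IsCP N) :
    strongConverseCapacity N ≤ geometricUpsilon α N := by
  refine le_iInf₂ fun M hM => EReal.le_of_forall_lt_iff_le.1 fun r hr => ?_
  exact iInf₂_le r (isStrongConverseRate_of_channelDivergence_lt hα hN hM hr)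

/-- A code of rate at least `r` also has rate at least any `r' < r`, so an achievable rate cannot
exceed a strong converse rate; one value of `ε` suffices for the contradiction. -/
theorem classicalCapacity_le_strongConverseCapacity (N : Matrix A A ℂ →ₗ[ℂ] Matrix B B ℂ) :
    classicalCapacity N ≤ strongConverseCapacity N := by
  refine iSup₂_le fun r hr => le_iInf₂ fun r' hr' => ?_
  rw [EReal.coe_le_coe_iff]
  by_contra! hlt
  obtain ⟨n, ⟨m, c, hm, hrm, hs⟩, hn⟩ := ((hr (1 / 2) (by norm_num) (by norm_num)).and
    (hr' (1 / 2) (by norm_num) (by norm_num))).exists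
  exact hn ⟨m, c, hm, hlt.le.trans hrm, hs⟩

end Converse

end QInfo

theorem mainTheorem7 {A B : Type*} [Fintype A] [Fintype B] [DecidableEq A] [DecidableEq B]
    [Nonempty A] (N : Matrix A A ℂ →ₗ[ℂ] Matrix B B ℂ) (hN : QInfo.IsChannel N)
    (α : ℝ) (hα₁ : 1 < α) (hα₂ : α ≤ 2) :
    QInfo.classicalCapacity N ≤ QInfo.strongConverseCapacity N ∧
    QInfo.strongConverseCapacity N ≤ QInfo.geometricUpsilon α N ∧
    QInfo.geometricUpsilon α N ≤ QInfo.maxUpsilon N ∧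
    QInfo.maxUpsilon N ≤ ((min (QInfo.Cbeta N) (QInfo.Czeta N) : ℝ) : EReal) := by
  refine ⟨QInfo.classicalCapacity_le_strongConverseCapacity N,
    QInfo.strongConverseCapacity_le_geometricUpsilon hα₁ hN.1,
    QInfo.geometricUpsilon_le_maxUpsilon hα₁ hN, ?_⟩
  rcases min_choice (QInfo.Cbeta N) (QInfo.Czeta N) with h | h <;> rw [h]
  · exact QInfo.maxUpsilon_le_Cbeta hN
  · exact QInfo.maxUpsilon_le_Czeta hN
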